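/- Let $k\ge 1$, let $S_k$ be the set of symmetric positive definite real $k\times k$ matrices and $M_k$ the set of all real $k\times k$ matrices. For $\mathcal V=(\mu,\Sigma,\nu)\in\mathbb R^k\times S_k\times(0,\infty)$ let $$f_{\mathcal V}(x)=\frac{\Gamma(\frac{\nu+k}{2})}{(\pi\nu)^{k/2}\,\Gamma(\frac{\nu}{2})}\,|\Sigma|^{-1/2}\Big(1+\frac{(x-\mu)'\Sigma^{-1}(x-\mu)}{\nu}\Big)^{-\frac{\nu+k}{2}},\qquad x\in\mathbb R^k,$$ be the Student $t$ density, and let $\mathrm P^{(n)}_{\mathcal V}$ be the joint distribution of $n$ independent observations $X_1,\dots,X_n$ with density $f_{\mathcal V}$. Let $\mathrm{vech}(A)$ be the vector of the upper triangular entries (diagonal included) of a matrix $A$. Define the scores $\mathcal L^{(2)}_{\mathcal V}(x)=D_{\mathrm{vech}(\Sigma)}\log f_{\mathcal V}(x)\in\mathbb R^{k(k+1)/2}$ (a gradient) and $\mathcal L^{(3)}_{\mathcal V}(x)=D_\nu\log f_{\mathcal V}(x)\in\mathbb R$, and the central sequences $\Delta^{(n)}_i(\mathcal V)=n^{-1/2}\sum_{j=1}^n\mathcal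 L^{(i)}_{\mathcal V}(X_j)$, $i=2,3$. Let $\Gamma_{22}(\mathcal V)$, $\Gamma_{23}(\mathcal V)$ and $\Gamma_{33}(\mathcal V)$ be the blocks of the Fisher information, that is, the covariance matrix of $\mathcal L^{(2)}_{\mathcal V}(X_1)$, its covariance vector with $\mathcal L^{(3)}_{\mathcal V}(X_1)$, and the variance of $\mathcal L^{(3)}_{\mathcal V}(X_1)$, when $X_1$ has density $f_{\mathcal V}$. The efficient central sequence and the efficient Fisher information for tail weight are $$\Delta_3^{(n)*}(\mathcal V)=\Delta_3^{(n)}(\mathcal V)-\Gamma_{23}(\mathcal V)'\,\Gamma_{22}(\mathcal V)^{-1}\Delta_2^{(n)}(\mathcal V),\qquad \Gamma_{33}^*(\mathcal V)=\Gamma_{33}(\mathcal V)-\Gamma_{23}(\mathcal V)'\,\Gamma_{22}(\mathcal V)^{-1}\Gamma_{23}(\mathcal V).$$ Lemma. For any $\mathcal V=(\mu,\Sigma,\nu)\in\mathbb R^k\times S_k\times(0,\infty)$ and any bounded sequence $\tau^{(n)}=(\tau_1^{(n)},\tau_2^{(n)},\tau_3^{(n)})\in\mathbb R^k\times M_k\times\mathbb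 R$ such that $\Sigma+n^{-1/2}\tau_2^{(n)}\in S_k$ and $\nu+n^{-1/2}\tau_3^{(n)}>0$ for all $n\ge1$, we have, under $\mathrm P^{(n)}_{\mathcal V}$ and as $n\to\infty$, $$\Delta_3^{(n)*}\big(\mathcal V+n^{-1/2}\tau^{(n)}\big)=\Delta_3^{(n)*}(\mathcal V)-\Gamma_{33}^*(\mathcal V)\,\tau_3^{(n)}+o_{\mathrm P}(1).$$ In particular, if $\tau_3^{(n)}=0$ for all $n\ge1$, $$\Delta_3^{(n)*}\big(\mu+n^{-1/2}\tau_1^{(n)},\Sigma+n^{-1/2}\tau_2^{(n)},\nu\big)=\Delta_3^{(n)*}(\mu,\Sigma,\nu)+o_{\mathrm P}(1).$$ -/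

import Mathlib

open MeasureTheory ProbabilityTheory Filter Topology
open scoped Matrix

noncomputable section

namespace StudentT

/-- Index set of `vech A` for a `k × k` matrix `A`: the upper triangular positions. -/
abbrev VechIdx (k : ℕ) : Type := {p : Fin k × Fin k // p.1 ≤ p.2}

/-- The upper triangular entries (diagonal included) of a square matrix. -/
def vech {k : ℕ} (A : Matrix (Fin k) (Fin k) ℝ) : VechIdx k → ℝ :=
  fun p => A p.1.1 p.1.2

/-- The symmetric matrix with given upper triangular entries. -/
def unvech {k : ℕ} (s : VechIdx k → ℝ) : Matrix (Fin k) (Fin k) ℝ :=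
  Matrix.of fun i j => s ⟨(min i j, max i j), min_le_max⟩

/-- The normalizing constant `c_{ν,k}`. -/
def normConst (k : ℕ) (ν : ℝ) : ℝ :=
  Real.Gamma ((ν + k) / 2) / ((Real.pi * ν) ^ ((k : ℝ) / 2) * Real.Gamma (ν / 2))

/-- The squared Mahalanobis distance `‖S^{-1/2} (x - μ)‖² = (x - μ)' S⁻¹ (x - μ)`. -/
def mahalanobisSq {k : ℕ} (μ : Fin k → ℝ) (S : Matrix (Fin k) (Fin k) ℝ) (x : Fin k → ℝ) : ℝ :=
  (x - μ) ⬝ᵥ (S⁻¹ *ᵥ (x - μ))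

/-- The `k`-dimensional Student `t` density with location `μ`, scatter `S`, tail weight `ν`. -/
def density {k : ℕ} (μ : Fin k → ℝ) (S : Matrix (Fin k) (Fin k) ℝ) (ν : ℝ) (x : Fin k → ℝ) : ℝ :=
  normConst k ν * S.det ^ (-(1 / 2) : ℝ)
    * (1 + mahalanobisSq μ S x / ν) ^ (-((ν + k) / 2))

/-- The Student `t` distribution on `ℝ^k`. -/
def law {k : ℕ} (μ : Fin k → ℝ) (S : Matrix (Fin k) (Fin k) ℝ) (ν : ℝ) : Measure (Fin k → ℝ) :=
  volume.withDensity fun x => ENNReal.ofReal (density μ S ν x)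

/-- The joint distribution of `n` independent observations from the Student `t` distribution. -/
def sampleLaw {k : ℕ} (n : ℕ) (μ : Fin k → ℝ) (S : Matrix (Fin k) (Fin k) ℝ) (ν : ℝ) :
    Measure (Fin n → Fin k → ℝ) :=
  Measure.pi fun _ => law μ S ν

/-- The scatter score: the gradient of the log-density with respect to `vech S`,
given by its partial derivatives. -/
def scoreScatter {k : ℕ} (μ : Fin k → ℝ) (S : Matrix (Fin k) (Fin k) ℝ) (ν : ℝ)
    (x : Fin k → ℝ) : VechIdx k → ℝ :=
  fun p => lineDeriv ℝ (fun s : VechIdx k → ℝ => Real.log (density μ (unvech s) ν x))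
    (vech S) (Pi.single p 1)

/-- The tail weight score: the derivative of the log-density with respect to `ν`. -/
def scoreTail {k : ℕ} (μ : Fin k → ℝ) (S : Matrix (Fin k) (Fin k) ℝ) (ν : ℝ)
    (x : Fin k → ℝ) : ℝ :=
  deriv (fun v : ℝ => Real.log (density μ S v x)) ν

/-- The scatter block of the Fisher information matrix (the covariance matrix of the score). -/
def Gamma22 {k : ℕ} (μ : Fin k → ℝ) (S : Matrix (Fin k) (Fin k) ℝ) (ν : ℝ) :
    Matrix (VechIdx k) (VechIdx k) ℝ :=
  Matrix.of fun p q =>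
    cov[fun x => scoreScatter μ S ν x p, fun x => scoreScatter μ S ν x q; law μ S ν]

/-- The scatter / tail weight block of the Fisher information matrix. -/
def Gamma23 {k : ℕ} (μ : Fin k → ℝ) (S : Matrix (Fin k) (Fin k) ℝ) (ν : ℝ) : VechIdx k → ℝ :=
  fun p => cov[fun x => scoreScatter μ S ν x p, scoreTail μ S ν; law μ S ν]

/-- The tail weight entry of the Fisher information matrix. -/
def Gamma33 {k : ℕ} (μ : Fin k → ℝ) (S : Matrix (Fin k) (Fin k) ℝ) (ν : ℝ) : ℝ :=
  cov[scoreTail μ S ν, scoreTail μ S ν; law μ S ν]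

/-- The efficient Fisher information for tail weight. -/
def Gamma33Star {k : ℕ} (μ : Fin k → ℝ) (S : Matrix (Fin k) (Fin k) ℝ) (ν : ℝ) : ℝ :=
  Gamma33 μ S ν - Gamma23 μ S ν ⬝ᵥ ((Gamma22 μ S ν)⁻¹ *ᵥ Gamma23 μ S ν)

/-- The scatter part of the central sequence. -/
def Delta2 {k : ℕ} (n : ℕ) (μ : Fin k → ℝ) (S : Matrix (Fin k) (Fin k) ℝ) (ν : ℝ)
    (X : Fin n → Fin k → ℝ) : VechIdx k → ℝ :=
  (√(n : ℝ))⁻¹ • ∑ i, scoreScatter μ S ν (X i)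

/-- The tail weight part of the central sequence. -/
def Delta3 {k : ℕ} (n : ℕ) (μ : Fin k → ℝ) (S : Matrix (Fin k) (Fin k) ℝ) (ν : ℝ)
    (X : Fin n → Fin k → ℝ) : ℝ :=
  (√(n : ℝ))⁻¹ * ∑ i, scoreTail μ S ν (X i)

/-- The efficient central sequence for tail weight. -/
def Delta3Star {k : ℕ} (n : ℕ) (μ : Fin k → ℝ) (S : Matrix (Fin k) (Fin k) ℝ) (ν : ℝ)
    (X : Fin n → Fin k → ℝ) : ℝ :=
  Delta3 n μ S ν X - Gamma23 μ S ν ⬝ᵥ ((Gamma22 μ S ν)⁻¹ *ᵥ Delta2 n μ S ν X)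

/-- `Z n = o_P(1)` under `P n` as `n → ∞`. -/
def IsLittleOP {E : ℕ → Type} [∀ n, MeasurableSpace (E n)] (P : ∀ n, Measure (E n))
    (Z : ∀ n, E n → ℝ) : Prop :=
  ∀ ε : ℝ, 0 < ε → Tendsto (fun n => P n {x | ε ≤ |Z n x|}) atTop (𝓝 0)

end StudentT

end

/-!
By elliptical symmetry `Γ₂₂⁻¹ Γ₂₃` is a multiple of `vech Σ`, so the efficient score depends on the
observation only through the weight `w = ν / (ν + d)`, with `d` the squared Mahalanobis distance:
it is the residual of the regression of `½ log w` on `w`. It is moreover Lipschitz in the parameter,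
uniformly in the observation. The increments of its centred sums therefore have variance tending to
zero, and by Chebyshev's inequality only the increment of its mean matters, to first order
the derivative of that mean: `-Γ₃₃*` in the tail weight direction, and zero in the location and
scatter directions, again by symmetry.
-/

namespace StudentT

section AsymptoticLinearity

theorem IsLittleOP.congr' {E : ℕ → Type} [∀ n, MeasurableSpace (E n)] {P : ∀ n, Measure (E n)}
    {Z Z' : ∀ n, E n → ℝ} (hZ : IsLittleOP P Z) (h : ∀ᶠ n in atTop, Z n = Z' n) :
    IsLittleOP P Z' := fun ε hε =>
  (hZ ε hε).congr' (h.mono fun n hn => by simp only [hn])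

theorem isLittleOP_of_tendsto_integral_of_tendsto_variance {E : ℕ → Type}
    [∀ n, MeasurableSpace (E n)] {P : ∀ n, Measure (E n)} [∀ n, IsProbabilityMeasure (P n)]
    {Z : ∀ n, E n → ℝ} (hZ : ∀ᶠ n in atTop, MemLp (Z n) 2 (P n))
    (hmean : Tendsto (fun n => ∫ x, Z n x ∂P n) atTop (𝓝 0))
    (hvar : Tendsto (fun n => Var[Z n; P n]) atTop (𝓝 0)) : IsLittleOP P Z := by
  intro ε hε
  have hbound : Tendsto (fun n => ENNReal.ofReal (Var[Z n; P n] / (ε / 2) ^ 2)) atTop (𝓝 0) := by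
    simpa using ENNReal.tendsto_ofReal (hvar.div_const ((ε / 2) ^ 2))
  refine tendsto_of_tendsto_of_tendsto_of_le_of_le' tendsto_const_nhds hbound
    (Eventually.of_forall fun n => zero_le) ?_
  have hsmall : ∀ᶠ n in atTop, |∫ x, Z n x ∂P n| < ε / 2 :=
    hmean.abs.eventually (gt_mem_nhds (by simpa using half_pos hε))
  filter_upwards [hZ, hsmall] with n hZn hn
  refine (measure_mono fun x hx => ?_).trans (meas_ge_le_variance_div_sq hZn (half_pos hε))
  have htri := abs_add_le (Z n x - ∫ x, Z n x ∂P n) (∫ x, Z n x ∂P n)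
  rw [sub_add_cancel] at htri
  simp only [Set.mem_ofPred_eq] at hx ⊢
  linarith

theorem tendsto_smul_sub_sub_of_hasFDerivAt {E F : Type*} [NormedAddCommGroup E]
    [NormedSpace ℝ E] [NormedAddCommGroup F] [NormedSpace ℝ F] {f : E → F} {f' : E →L[ℝ] F}
    {x : E} (hf : HasFDerivAt f f' x) {c : ℕ → ℝ} (hc : Tendsto c atTop atTop) {h : ℕ → E}
    {C : ℝ} (hh : ∀ n, ‖h n‖ ≤ C) :
    Tendsto (fun n => c n • (f (x + (c n)⁻¹ • h n) - f x) - f' (h n)) atTop (𝓝 0) := by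
  have hO : (fun n => (c n)⁻¹ • h n) =O[atTop] fun n => (c n)⁻¹ :=
    .of_bound C <| Eventually.of_forall fun n => by
      rw [norm_smul, mul_comm]
      gcongr
      exact hh n
  have h0 : Tendsto (fun n => (c n)⁻¹ • h n) atTop (𝓝 0) :=
    hO.trans_tendsto (tendsto_inv_atTop_zero.comp hc)
  have ho := ((hasFDerivAt_iff_isLittleO_nhds_zero.1 hf).comp_tendsto h0).trans_isBigO hO
  have hsmul := (Asymptotics.isBigO_refl c atTop).smul_isLittleO ho
  refine (Asymptotics.isLittleO_one_iff ℝ).1 ((hsmul.congr' ?_ .rfl).trans_isBigO ?_)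
  · filter_upwards [hc.eventually_ne_atTop 0] with n hn
    simp only [Function.comp, map_smul, smul_sub, smul_inv_smul₀ hn]
  · refine .of_bound 1 <| Eventually.of_forall fun n => ?_
    rcases eq_or_ne (c n) 0 with hn | hn <;> simp [hn]

theorem aestronglyMeasurable_of_hasFDerivAt {Ω : Type*} [MeasurableSpace Ω] {P : Measure Ω}
    {E : Type*} [NormedAddCommGroup E] [NormedSpace ℝ E] [FiniteDimensional ℝ E]
    {f : E → Ω → ℝ} {f' : Ω → E →L[ℝ] ℝ} {x₀ : E}
    (hf : ∀ x, AEStronglyMeasurable (f x) P)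
    (hderiv : ∀ ω, HasFDerivAt (fun x => f x ω) (f' ω) x₀) : AEStronglyMeasurable f' P := by
  have happly (v : E) : AEStronglyMeasurable (fun ω => f' ω v) P := by
    refine aestronglyMeasurable_of_tendsto_ae atTop
      (f := fun (n : ℕ) ω => (n : ℝ) • (f (x₀ + (n : ℝ)⁻¹ • v) ω - f x₀ ω))
      (fun n => ((hf (x₀ + (n : ℝ)⁻¹ • v)).sub (hf x₀)).const_smul (n : ℝ))
      (ae_of_all _ fun ω => ?_)
    have := tendsto_smul_sub_sub_of_hasFDerivAt (hderiv ω) tendsto_natCast_atTop_atTop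
      (h := fun _ => v) (fun _ => le_rfl)
    simpa using this.add_const (f' ω v)
  let e : (E →L[ℝ] ℝ) ≃L[ℝ] (Fin (Module.finrank ℝ E) → ℝ) :=
    LinearEquiv.toContinuousLinearEquiv <|
      LinearMap.toContinuousLinearMap.symm ≪≫ₗ ((Module.finBasis ℝ E).constr ℝ).symm
  have he : AEStronglyMeasurable (fun ω => e (f' ω)) P :=
    (aemeasurable_pi_lambda _ fun i => (happly (Module.finBasis ℝ E i)).aemeasurable)
      |>.aestronglyMeasurable
  simpa using e.symm.continuous.comp_aestronglyMeasurable he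

variable {Ω : Type} [MeasurableSpace Ω] {P : Measure Ω} [IsProbabilityMeasure P]

theorem memLp_sum_pi {g : Ω → ℝ} (n : ℕ) (hg : MemLp g 2 P) :
    MemLp (fun X : Fin n → Ω => ∑ i, g (X i)) 2 (Measure.pi fun _ => P) :=
  memLp_finsetSum _ fun i _ =>
    hg.comp_measurePreserving (measurePreserving_eval (fun _ : Fin n => P) i)

theorem integral_inv_sqrt_mul_sum_pi {g : Ω → ℝ} (n : ℕ) (hg : Integrable g P) :
    ∫ X, (√(n : ℝ))⁻¹ * ∑ i, g (X i) ∂(Measure.pi fun _ : Fin n => P) = √n * ∫ x, g x ∂P := by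
  have heval (i : Fin n) : ∫ X, g (X i) ∂(Measure.pi fun _ : Fin n => P) = ∫ x, g x ∂P :=
    integral_comp_eval (μ := fun _ : Fin n => P) hg.aestronglyMeasurable
  have hint (i : Fin n) : Integrable (fun X : Fin n → Ω => g (X i)) (Measure.pi fun _ => P) :=
    (measurePreserving_eval (fun _ : Fin n => P) i).integrable_comp_of_integrable hg
  rw [integral_const_mul, integral_finsetSum _ fun i _ => hint i]
  simp only [heval, Finset.sum_const, Finset.card_univ, Fintype.card_fin, nsmul_eq_mul]
  rw [← mul_assoc, inv_mul_eq_div, Real.div_sqrt]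

theorem variance_inv_sqrt_mul_sum_pi {g : Ω → ℝ} {n : ℕ} (hn : n ≠ 0) (hg : MemLp g 2 P) :
    Var[fun X => (√(n : ℝ))⁻¹ * ∑ i, g (X i); Measure.pi fun _ : Fin n => P] = Var[g; P] := by
  have hsum := variance_sum_pi (μ := fun _ : Fin n => P) (X := fun _ => g) fun _ => hg
  simp only [Finset.sum_fn, Finset.sum_const, Finset.card_univ, Fintype.card_fin,
    nsmul_eq_mul] at hsum
  rw [variance_const_mul, hsum, inv_pow, Real.sq_sqrt n.cast_nonneg,
    inv_mul_cancel_left₀ (Nat.cast_ne_zero.2 hn)]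

theorem isLittleOP_inv_sqrt_mul_sum_sub_const {g : ℕ → Ω → ℝ}
    (hmeas : ∀ n, AEStronglyMeasurable (g n) P) {b : ℕ → ℝ} (hb : Tendsto b atTop (𝓝 0))
    (hgb : ∀ᶠ n in atTop, ∀ x, |g n x| ≤ b n) {m : ℕ → ℝ}
    (hm : Tendsto (fun n : ℕ => √n * ∫ x, g n x ∂P - m n) atTop (𝓝 0)) :
    IsLittleOP (fun n => Measure.pi fun _ : Fin n => P) fun n X =>
      (√(n : ℝ))⁻¹ * ∑ i, g n (X i) - m n := by
  have hmemLp : ∀ᶠ n in atTop, MemLp (g n) 2 P := hgb.mono fun n hn =>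
    .of_bound (hmeas n) (b n) (ae_of_all _ hn)
  have hvar : ∀ᶠ n in atTop, Var[g n; P] ≤ b n ^ 2 := by
    filter_upwards [hgb] with n hn
    have h := variance_le_sq_of_bounded (μ := P) (X := g n) (a := -b n) (b := b n)
      (ae_of_all _ fun x => abs_le.1 (hn x)) (hmeas n).aemeasurable
    rwa [sub_neg_eq_add, add_self_div_two] at h
  refine isLittleOP_of_tendsto_integral_of_tendsto_variance ?_ (hm.congr' ?_)
    (squeeze_zero' (.of_forall fun n => variance_nonneg _ _) ?_ (by simpa using hb.pow 2))
  · exact hmemLp.mono fun n hn => ((memLp_sum_pi n hn).const_mul _).sub (memLp_const _)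
  · filter_upwards [hmemLp] with n hn
    rw [integral_sub (((memLp_sum_pi n hn).const_mul _).integrable one_le_two)
      (integrable_const _), integral_inv_sqrt_mul_sum_pi n (hn.integrable one_le_two)]
    simp
  · filter_upwards [hmemLp, hvar, eventually_ne_atTop 0] with n hn hvarn hn0
    rwa [variance_sub_const ((memLp_sum_pi n hn).const_mul _).aestronglyMeasurable,
      variance_inv_sqrt_mul_sum_pi hn0 hn]

theorem isLittleOP_inv_sqrt_mul_sum_sub {E : Type*} [NormedAddCommGroup E] [NormedSpace ℝ E]
    [FiniteDimensional ℝ E] {ψ : E → Ω → ℝ} {ψ' : Ω → E →L[ℝ] ℝ} {θ₀ : E}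
    (hmeas : ∀ θ, AEStronglyMeasurable (ψ θ) P) (hint : Integrable (ψ θ₀) P) {K : ℝ}
    (hlip : ∀ᶠ θ in 𝓝 θ₀, ∀ x, |ψ θ x - ψ θ₀ x| ≤ K * ‖θ - θ₀‖)
    (hderiv : ∀ x, HasFDerivAt (fun θ => ψ θ x) (ψ' x) θ₀) {h : ℕ → E} {C : ℝ}
    (hh : ∀ n, ‖h n‖ ≤ C) :
    IsLittleOP (fun n => Measure.pi fun _ : Fin n => P) fun n X =>
      (√(n : ℝ))⁻¹ * ∑ i, ψ (θ₀ + (√(n : ℝ))⁻¹ • h n) (X i) -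
        ((√(n : ℝ))⁻¹ * ∑ i, ψ θ₀ (X i) + ∫ x, ψ' x (h n) ∂P) := by
  have hsqrt : Tendsto (fun n : ℕ => √(n : ℝ)) atTop atTop :=
    Real.tendsto_sqrt_atTop.comp tendsto_natCast_atTop_atTop
  obtain ⟨hint', hmean⟩ := hasFDerivAt_integral_of_dominated_loc_of_lip' hlip
    (fun θ _ => hmeas θ) hint (aestronglyMeasurable_of_hasFDerivAt hmeas hderiv)
    (ae_of_all _ fun x θ hθ => hθ x) (integrable_const K) (ae_of_all _ hderiv)
  have hstep (n : ℕ) : ‖(√(n : ℝ))⁻¹ • h n‖ ≤ (√(n : ℝ))⁻¹ * C := by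
    rw [norm_smul, Real.norm_of_nonneg (by positivity)]
    gcongr
    exact hh n
  have hsmall : Tendsto (fun n : ℕ => (√(n : ℝ))⁻¹ * C) atTop (𝓝 0) := by
    simpa using (tendsto_inv_atTop_zero.comp hsqrt).mul_const C
  have hlocal : Tendsto (fun n : ℕ => θ₀ + (√(n : ℝ))⁻¹ • h n) atTop (𝓝 θ₀) := by
    simpa using (squeeze_zero_norm hstep hsmall).const_add θ₀
  have hbound : ∀ᶠ n : ℕ in atTop, ∀ x,
      |ψ (θ₀ + (√(n : ℝ))⁻¹ • h n) x - ψ θ₀ x| ≤ |K| * ((√(n : ℝ))⁻¹ * C) := by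
    filter_upwards [hlocal.eventually hlip] with n hn x
    refine (hn x).trans ?_
    rw [add_sub_cancel_left]
    gcongr
    exacts [le_abs_self K, hstep n]
  refine (isLittleOP_inv_sqrt_mul_sum_sub_const (fun n => (hmeas _).sub (hmeas θ₀))
    (by simpa using hsmall.const_mul |K|) hbound (m := fun n => ∫ x, ψ' x (h n) ∂P) ?_).congr' ?_
  · refine (tendsto_smul_sub_sub_of_hasFDerivAt hmean hsqrt hh).congr' ?_
    filter_upwards [hbound] with n hn
    have hdiff : Integrable (fun x => ψ (θ₀ + (√(n : ℝ))⁻¹ • h n) x - ψ θ₀ x) P :=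
      .of_bound ((hmeas _).sub (hmeas θ₀)) _ (ae_of_all _ hn)
    rw [← integral_sub ((hdiff.add hint).congr (.of_forall fun x => sub_add_cancel _ _)) hint,
      ContinuousLinearMap.integral_apply hint', smul_eq_mul]
    rfl
  · refine .of_forall fun n => funext fun X => ?_
    simp only [Pi.sub_apply, Finset.sum_sub_distrib]
    ring

end AsymptoticLinearity

section QuadraticForm

variable {ι : Type*} [Fintype ι]

theorem dotProduct_self_nonneg (y : ι → ℝ) : 0 ≤ y ⬝ᵥ y := by
  simpa using dotProduct_star_self_nonneg y

theorem norm_sq_le_dotProduct_self (y : ι → ℝ) : ‖y‖ ^ 2 ≤ y ⬝ᵥ y := by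
  rw [← Real.le_sqrt (norm_nonneg y) (dotProduct_self_nonneg y)]
  refine (pi_norm_le_iff_of_nonneg (Real.sqrt_nonneg _)).2 fun i => Real.abs_le_sqrt ?_
  rw [sq]
  exact Finset.single_le_sum (fun j _ => mul_self_nonneg (y j)) (Finset.mem_univ i)

theorem abs_apply_mul_apply_le (y : ι → ℝ) (i j : ι) : |y i * y j| ≤ y ⬝ᵥ y := by
  refine le_trans ?_ (norm_sq_le_dotProduct_self y)
  rw [abs_mul, sq]
  exact mul_le_mul (norm_le_pi_norm y i) (norm_le_pi_norm y j) (abs_nonneg _) (norm_nonneg _)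

theorem abs_dotProduct_le (u v : ι → ℝ) : |u ⬝ᵥ v| ≤ Fintype.card ι * (‖u‖ * ‖v‖) := by
  calc |u ⬝ᵥ v| ≤ ∑ i, |u i * v i| := Finset.abs_sum_le_sum_abs _ _
    _ ≤ ∑ _i : ι, ‖u‖ * ‖v‖ := by
        gcongr with i
        rw [abs_mul]
        exact mul_le_mul (norm_le_pi_norm u i) (norm_le_pi_norm v i) (abs_nonneg _) (norm_nonneg _)
    _ = Fintype.card ι * (‖u‖ * ‖v‖) := by
        rw [Finset.sum_const, Finset.card_univ, nsmul_eq_mul]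

open scoped Matrix.Norms.Operator in
theorem abs_dotProduct_mulVec_le (D : Matrix ι ι ℝ) (u v : ι → ℝ) :
    |u ⬝ᵥ (D *ᵥ v)| ≤ Fintype.card ι * (‖D‖ * (‖u‖ * ‖v‖)) := by
  calc |u ⬝ᵥ (D *ᵥ v)| ≤ Fintype.card ι * (‖u‖ * ‖D *ᵥ v‖) := abs_dotProduct_le _ _
    _ ≤ Fintype.card ι * (‖u‖ * (‖D‖ * ‖v‖)) := by
        gcongr
        exact Matrix.linfty_opNorm_mulVec D v
    _ = Fintype.card ι * (‖D‖ * (‖u‖ * ‖v‖)) := by ring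

theorem mulVec_dotProduct_mulVec_le (T : Matrix ι ι ℝ) (y : ι → ℝ) :
    (T *ᵥ y) ⬝ᵥ (T *ᵥ y) ≤ (T * Tᵀ).trace * (y ⬝ᵥ y) := by
  rw [Matrix.trace, Finset.sum_mul]
  refine Finset.sum_le_sum fun i _ => ?_
  simpa only [Matrix.mulVec, dotProduct, Matrix.diag_apply, Matrix.mul_apply,
    Matrix.transpose_apply, sq] using Finset.sum_mul_sq_le_sq_mul_sq Finset.univ (T i) y

theorem eq_zero_of_forall_dotProduct_mulVec_eq_zero {D : Matrix ι ι ℝ} (hD : D.IsSymm)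
    (h : ∀ y : ι → ℝ, y ⬝ᵥ (D *ᵥ y) = 0) : D = 0 := by
  classical
  ext i j
  have hij := h (Pi.single i 1 + Pi.single j 1)
  have hi := h (Pi.single i 1)
  have hj := h (Pi.single j 1)
  have hsymm := hD.apply i j
  simp only [Matrix.mulVec_add, dotProduct_add, add_dotProduct, single_one_dotProduct,
    Matrix.mulVec_single_one, Matrix.col_apply] at hij hi hj
  rw [Matrix.zero_apply]
  linarith

end QuadraticForm

section Spherical

variable {ι : Type*} [Fintype ι]

theorem integrable_apply_mul_apply {P : Measure (ι → ℝ)} {φ : ℝ → ℝ} (hφ : Measurable φ)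
    (hint : Integrable (fun y => (y ⬝ᵥ y) * φ (y ⬝ᵥ y)) P) (i j : ι) :
    Integrable (fun y => y i * y j * φ (y ⬝ᵥ y)) P := by
  refine hint.mono (Measurable.aestronglyMeasurable ?_) (.of_forall fun y => ?_)
  · exact ((measurable_pi_apply i).mul (measurable_pi_apply j)).mul
      (hφ.comp (by fun_prop : Continuous fun y : ι → ℝ => y ⬝ᵥ y).measurable)
  rw [norm_mul, norm_mul _ (φ _)]
  gcongr
  exact (abs_apply_mul_apply_le y i j).trans (le_abs_self _)

variable [DecidableEq ι]

/-- A measure on `ι → ℝ` is spherical when it is invariant under all orthogonal matrices. -/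
def IsSpherical (P : Measure (ι → ℝ)) : Prop :=
  ∀ T : Matrix ι ι ℝ, Tᵀ * T = 1 → MeasurePreserving (fun y => T *ᵥ y) P P

theorem mulVec_dotProduct_mulVec_of_orthogonal {T : Matrix ι ι ℝ} (hT : Tᵀ * T = 1) (y : ι → ℝ) :
    (T *ᵥ y) ⬝ᵥ (T *ᵥ y) = y ⬝ᵥ y := by
  rw [Matrix.dotProduct_mulVec, Matrix.vecMul_mulVec, ← Matrix.dotProduct_mulVec, hT,
    Matrix.one_mulVec]

theorem measurableEmbedding_mulVec {T : Matrix ι ι ℝ} (hT : Tᵀ * T = 1) :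
    MeasurableEmbedding fun y : ι → ℝ => T *ᵥ y :=
  (continuous_const.matrix_mulVec continuous_id).measurableEmbedding
    (Function.LeftInverse.injective (g := fun y => Tᵀ *ᵥ y) fun y => by
      simp only [id, Matrix.mulVec_mulVec, hT, Matrix.one_mulVec])

theorem isSpherical_volume : IsSpherical (volume : Measure (ι → ℝ)) := fun T hT => by
  have hdet : |T.det| = 1 := by
    have h := congrArg Matrix.det hT
    rw [Matrix.det_mul, Matrix.det_transpose, Matrix.det_one, ← abs_mul_abs_self] at h
    nlinarith [abs_nonneg T.det]
  refine ⟨(measurableEmbedding_mulVec hT).measurable, ?_⟩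
  have h := Real.map_matrix_volume_pi_eq_smul_volume_pi (M := T) fun h => by simp [h] at hdet
  rwa [abs_inv, hdet, inv_one, ENNReal.ofReal_one, one_smul] at h

namespace IsSpherical

variable {P : Measure (ι → ℝ)} {φ : ℝ → ℝ}

theorem integral_comp_mulVec (hP : IsSpherical P) {T : Matrix ι ι ℝ} (hT : Tᵀ * T = 1)
    (f : (ι → ℝ) → ℝ) : ∫ y, f (T *ᵥ y) ∂P = ∫ y, f y ∂P :=
  (hP T hT).integral_comp (measurableEmbedding_mulVec hT) f

theorem tilted (hP : IsSpherical P) (φ : ℝ → ℝ) :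
    IsSpherical (P.tilted fun y => φ (y ⬝ᵥ y)) := fun T hT => by
  refine ⟨(measurableEmbedding_mulVec hT).measurable, ?_⟩
  ext s hs
  have h := (hP T hT).setLIntegral_comp_preimage_emb (measurableEmbedding_mulVec hT)
    (fun y => ENNReal.ofReal (Real.exp (φ (y ⬝ᵥ y)) / ∫ x, Real.exp (φ (x ⬝ᵥ x)) ∂P)) s
  simp only [mulVec_dotProduct_mulVec_of_orthogonal hT] at h
  rw [(measurableEmbedding_mulVec hT).map_apply,
    tilted_apply' _ _ ((measurableEmbedding_mulVec hT).measurable hs), tilted_apply' _ _ hs, h]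

theorem integral_eq_zero_of_odd (hP : IsSpherical P) {f : (ι → ℝ) → ℝ} (hf : ∀ y, f (-y) = -f y) :
    ∫ y, f y ∂P = 0 := by
  have h := hP.integral_comp_mulVec (T := -1) (by simp) f
  simp only [Matrix.neg_mulVec, Matrix.one_mulVec, hf, integral_neg] at h
  linarith

theorem integral_apply_mul_apply_of_ne (hP : IsSpherical P) {i j : ι} (hij : i ≠ j) :
    ∫ y, y i * y j * φ (y ⬝ᵥ y) ∂P = 0 := by
  set T : Matrix ι ι ℝ := Matrix.diagonal fun l => if l = i then -1 else 1 with hT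
  have horth : Tᵀ * T = 1 := by
    rw [hT, Matrix.diagonal_transpose, Matrix.diagonal_mul_diagonal, ← Matrix.diagonal_one]
    congr 1
    ext l
    split_ifs <;> simp
  have h := hP.integral_comp_mulVec horth fun y => y i * y j * φ (y ⬝ᵥ y)
  simp only [mulVec_dotProduct_mulVec_of_orthogonal horth] at h
  simp only [hT, Matrix.mulVec_diagonal, if_true, if_neg hij.symm, neg_mul, one_mul,
    integral_neg] at h
  linarith

theorem integral_apply_mul_self_eq (hP : IsSpherical P) (i j : ι) :
    ∫ y, y i * y i * φ (y ⬝ᵥ y) ∂P = ∫ y, y j * y j * φ (y ⬝ᵥ y) ∂P := by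
  have horth : ((Equiv.swap i j).permMatrix ℝ)ᵀ * (Equiv.swap i j).permMatrix ℝ = 1 := by
    rw [Matrix.transpose_permMatrix, ← Matrix.permMatrix_mul]
    simp
  have h := hP.integral_comp_mulVec horth fun y => y j * y j * φ (y ⬝ᵥ y)
  simp only [mulVec_dotProduct_mulVec_of_orthogonal horth] at h
  simpa only [Matrix.permMatrix_mulVec, Function.comp, Equiv.swap_apply_right] using h

theorem integral_apply_mul_apply (hP : IsSpherical P) (hφ : Measurable φ)
    (hint : Integrable (fun y => (y ⬝ᵥ y) * φ (y ⬝ᵥ y)) P) (i j : ι) :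
    ∫ y, y i * y j * φ (y ⬝ᵥ y) ∂P =
      (1 : Matrix ι ι ℝ) i j * ((∫ y, (y ⬝ᵥ y) * φ (y ⬝ᵥ y) ∂P) / Fintype.card ι) := by
  have hmoment := integrable_apply_mul_apply hφ hint
  rcases eq_or_ne i j with rfl | hij
  · have hsum : ∫ y, (y ⬝ᵥ y) * φ (y ⬝ᵥ y) ∂P =
        Fintype.card ι * ∫ y, y i * y i * φ (y ⬝ᵥ y) ∂P := by
      simp only [dotProduct, Finset.sum_mul] at hmoment ⊢
      rw [integral_finsetSum _ fun l _ => hmoment l l, ← nsmul_eq_mul, ← Finset.card_univ,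
        ← Finset.sum_const]
      exact Finset.sum_congr rfl fun l _ => hP.integral_apply_mul_self_eq l i
    rw [hsum, Matrix.one_apply_eq, one_mul, mul_div_cancel_left₀]
    have : Nonempty ι := ⟨i⟩
    exact Nat.cast_ne_zero.2 Fintype.card_ne_zero
  · rw [hP.integral_apply_mul_apply_of_ne hij, Matrix.one_apply_ne hij, zero_mul]

theorem integral_dotProduct_mulVec (hP : IsSpherical P) (hφ : Measurable φ)
    (hint : Integrable (fun y => (y ⬝ᵥ y) * φ (y ⬝ᵥ y)) P) (D : Matrix ι ι ℝ) :
    ∫ y, (y ⬝ᵥ (D *ᵥ y)) * φ (y ⬝ᵥ y) ∂P =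
      D.trace / Fintype.card ι * ∫ y, (y ⬝ᵥ y) * φ (y ⬝ᵥ y) ∂P := by
  have hterm (i j : ι) : Integrable (fun y => D i j * (y i * y j * φ (y ⬝ᵥ y))) P :=
    (integrable_apply_mul_apply hφ hint i j).const_mul (D i j)
  have hexpand (y : ι → ℝ) :
      (y ⬝ᵥ (D *ᵥ y)) * φ (y ⬝ᵥ y) = ∑ i, ∑ j, D i j * (y i * y j * φ (y ⬝ᵥ y)) := by
    simp only [dotProduct, Matrix.mulVec, Finset.sum_mul, Finset.mul_sum]
    exact Finset.sum_congr rfl fun i _ => Finset.sum_congr rfl fun j _ => by ring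
  simp only [hexpand]
  rw [integral_finsetSum _ fun i _ => integrable_finsetSum _ fun j _ => hterm i j]
  simp only [integral_finsetSum _ fun j _ => hterm _ j, integral_const_mul,
    hP.integral_apply_mul_apply hφ hint]
  simp only [← mul_assoc, ← Finset.sum_mul, Matrix.one_apply, mul_ite, mul_one, mul_zero,
    Finset.sum_ite_eq, Finset.mem_univ, if_true, Matrix.trace, Matrix.diag_apply]
  ring

end IsSpherical

end Spherical

section RadialPowerLaw

theorem lintegral_exp_neg_mul_dotProduct_self {ι : Type*} [Fintype ι] {s : ℝ} (hs : 0 < s) :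
    ∫⁻ y : ι → ℝ, ENNReal.ofReal (Real.exp (-(s * (y ⬝ᵥ y)))) =
      ENNReal.ofReal ((Real.pi / s) ^ ((Fintype.card ι : ℝ) / 2)) := by
  have hprod (y : ι → ℝ) : Real.exp (-(s * (y ⬝ᵥ y))) = ∏ i, Real.exp (-s * y i ^ 2) := by
    rw [← Real.exp_sum, dotProduct, Finset.mul_sum, ← Finset.sum_neg_distrib]
    exact congrArg Real.exp (Finset.sum_congr rfl fun i _ => by ring)
  simp only [hprod]
  rw [volume_pi, ← ofReal_integral_eq_lintegral_ofReal
      (Integrable.fintype_prod fun _ => integrable_exp_neg_mul_sq hs)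
      (.of_forall fun y => Finset.prod_nonneg fun i _ => (Real.exp_pos _).le),
    integral_fintype_prod_eq_pow (fun x : ℝ => Real.exp (-s * x ^ 2)), integral_gaussian,
    Real.sqrt_eq_rpow, ← Real.rpow_natCast, ← Real.rpow_mul (by positivity), one_div_mul_eq_div]

theorem lintegral_rpow_mul_exp_neg_mul_Ioi {a r : ℝ} (ha : 0 < a) (hr : 0 < r) :
    ∫⁻ s in Set.Ioi (0 : ℝ), ENNReal.ofReal (s ^ (a - 1) * Real.exp (-(r * s))) =
      ENNReal.ofReal ((1 / r) ^ a * Real.Gamma a) := by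
  have h := Real.integral_rpow_mul_exp_neg_mul_Ioi ha hr
  have hpos : 0 < (1 / r) ^ a * Real.Gamma a := by have := Real.Gamma_pos_of_pos ha; positivity
  rw [← h, ofReal_integral_eq_lintegral_ofReal]
  · exact not_imp_comm.1 integral_undef (by rw [h]; exact hpos.ne')
  · filter_upwards [ae_restrict_mem measurableSet_Ioi] with s (hs : 0 < s)
    simp only [Pi.zero_apply]
    positivity

/-- The bounded radial factor `(1 + ‖y‖²)⁻¹` of the standardized Student density, which is
proportional to a power of it. -/
noncomputable def radialWeight {k : ℕ} (y : Fin k → ℝ) : ℝ := (1 + y ⬝ᵥ y)⁻¹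

variable {k : ℕ} {a : ℝ}

theorem one_le_one_add_dotProduct_self (y : Fin k → ℝ) : 1 ≤ 1 + y ⬝ᵥ y :=
  le_add_of_nonneg_right (dotProduct_self_nonneg y)

theorem radialWeight_pos (y : Fin k → ℝ) : 0 < radialWeight y :=
  inv_pos.2 (one_pos.trans_le (one_le_one_add_dotProduct_self y))

theorem radialWeight_le_one (y : Fin k → ℝ) : radialWeight y ≤ 1 :=
  inv_le_one_of_one_le₀ (one_le_one_add_dotProduct_self y)

@[fun_prop]
theorem continuous_radialWeight : Continuous (radialWeight (k := k)) :=
  Continuous.inv₀ (by fun_prop) fun y => (one_pos.trans_le (one_le_one_add_dotProduct_self y)).ne'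

theorem continuous_log_radialWeight : Continuous fun y : Fin k → ℝ => Real.log (radialWeight y) :=
  continuous_radialWeight.log fun y => (radialWeight_pos y).ne'

theorem lintegral_gaussian_mixture {s : ℝ} (hs : 0 < s) :
    ∫⁻ y : Fin k → ℝ, ENNReal.ofReal (s ^ (a - 1) * Real.exp (-((1 + y ⬝ᵥ y) * s))) =
      ENNReal.ofReal (Real.pi ^ ((k : ℝ) / 2)) *
        ENNReal.ofReal (s ^ (a - k / 2 - 1) * Real.exp (-(1 * s))) := by
  have hsplit (y : Fin k → ℝ) : ENNReal.ofReal (s ^ (a - 1) * Real.exp (-((1 + y ⬝ᵥ y) * s))) =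
      ENNReal.ofReal (s ^ (a - 1) * Real.exp (-s)) *
        ENNReal.ofReal (Real.exp (-(s * (y ⬝ᵥ y)))) := by
    rw [← ENNReal.ofReal_mul (by positivity), mul_assoc, ← Real.exp_add]
    ring_nf
  simp only [hsplit]
  rw [lintegral_const_mul' _ _ ENNReal.ofReal_ne_top, lintegral_exp_neg_mul_dotProduct_self hs,
    ← ENNReal.ofReal_mul (by positivity), ← ENNReal.ofReal_mul (by positivity),
    Real.div_rpow Real.pi_pos.le hs.le, sub_right_comm,
    Real.rpow_sub hs (a - 1), Fintype.card_fin, one_mul]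
  congr 1
  ring

theorem lintegral_radialWeight_rpow (ha : (k : ℝ) / 2 < a) :
    ∫⁻ y : Fin k → ℝ, ENNReal.ofReal (radialWeight y ^ a) =
      ENNReal.ofReal (Real.pi ^ ((k : ℝ) / 2) * Real.Gamma (a - k / 2) / Real.Gamma a) := by
  have ha0 : 0 < a := lt_of_le_of_lt (by positivity) ha
  have hΓ := Real.Gamma_pos_of_pos ha0
  rw [ENNReal.ofReal_div_of_pos hΓ, ENNReal.eq_div_iff (by simpa using hΓ) ENNReal.ofReal_ne_top]
  calc ENNReal.ofReal (Real.Gamma a) * ∫⁻ y : Fin k → ℝ, ENNReal.ofReal (radialWeight y ^ a)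
    _ = ∫⁻ y : Fin k → ℝ, ∫⁻ s in Set.Ioi (0 : ℝ),
          ENNReal.ofReal (s ^ (a - 1) * Real.exp (-((1 + y ⬝ᵥ y) * s))) := by
      rw [← lintegral_const_mul' _ _ ENNReal.ofReal_ne_top]
      refine lintegral_congr fun y => ?_
      rw [lintegral_rpow_mul_exp_neg_mul_Ioi ha0
        (one_pos.trans_le (one_le_one_add_dotProduct_self y)), ← ENNReal.ofReal_mul hΓ.le,
        mul_comm, one_div, radialWeight]
    _ = ∫⁻ s in Set.Ioi (0 : ℝ), ENNReal.ofReal (Real.pi ^ ((k : ℝ) / 2)) *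
          ENNReal.ofReal (s ^ (a - k / 2 - 1) * Real.exp (-(1 * s))) := by
      rw [lintegral_lintegral_swap (Measurable.aemeasurable ?_)]
      · exact setLIntegral_congr_fun measurableSet_Ioi fun s hs => lintegral_gaussian_mixture hs
      · have : Continuous fun p : (Fin k → ℝ) × ℝ => p.1 ⬝ᵥ p.1 := by fun_prop
        exact ENNReal.measurable_ofReal.comp (by fun_prop)
    _ = ENNReal.ofReal (Real.pi ^ ((k : ℝ) / 2) * Real.Gamma (a - k / 2)) := by
      rw [lintegral_const_mul' _ _ ENNReal.ofReal_ne_top,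
        lintegral_rpow_mul_exp_neg_mul_Ioi (sub_pos.2 ha) one_pos,
        ← ENNReal.ofReal_mul (by positivity), div_one, Real.one_rpow, one_mul]

theorem exp_mul_log_radialWeight (t : ℝ) (y : Fin k → ℝ) :
    Real.exp (t * Real.log (radialWeight y)) = radialWeight y ^ t := by
  rw [Real.rpow_def_of_pos (radialWeight_pos y), mul_comm]

theorem integrable_exp_mul_log_radialWeight (ha : (k : ℝ) / 2 < a) :
    Integrable fun y : Fin k → ℝ => Real.exp (a * Real.log (radialWeight y)) := by
  refine ⟨(continuous_const.mul continuous_log_radialWeight).rexp.aestronglyMeasurable, ?_⟩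
  rw [hasFiniteIntegral_iff_ofReal (.of_forall fun y => (Real.exp_pos _).le)]
  simp only [exp_mul_log_radialWeight, lintegral_radialWeight_rpow ha, ENNReal.ofReal_lt_top]

theorem mgf_log_radialWeight (ha : (k : ℝ) / 2 < a) :
    mgf (fun y : Fin k → ℝ => Real.log (radialWeight y)) volume a =
      Real.pi ^ ((k : ℝ) / 2) * Real.Gamma (a - k / 2) / Real.Gamma a := by
  have ha0 : 0 < a := lt_of_le_of_lt (by positivity) ha
  rw [mgf, integral_eq_lintegral_of_nonneg_ae (.of_forall fun y => (Real.exp_pos _).le)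
    (integrable_exp_mul_log_radialWeight ha).aestronglyMeasurable]
  simp only [exp_mul_log_radialWeight, lintegral_radialWeight_rpow ha]
  have := Real.Gamma_pos_of_pos ha0
  have := Real.Gamma_pos_of_pos (sub_pos.2 ha)
  exact ENNReal.toReal_ofReal (by positivity)

theorem mgf_log_radialWeight_pos (ha : (k : ℝ) / 2 < a) :
    0 < mgf (fun y : Fin k → ℝ => Real.log (radialWeight y)) volume a :=
  mgf_pos' (NeZero.ne _) (integrable_exp_mul_log_radialWeight ha)

theorem mgf_log_radialWeight_add_one (ha : (k : ℝ) / 2 < a) :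
    mgf (fun y : Fin k → ℝ => Real.log (radialWeight y)) volume (a + 1) =
      (1 - k / 2 / a) * mgf (fun y : Fin k → ℝ => Real.log (radialWeight y)) volume a := by
  have ha0 : 0 < a := lt_of_le_of_lt (by positivity) ha
  rw [mgf_log_radialWeight ha, mgf_log_radialWeight (by linarith), add_sub_right_comm,
    Real.Gamma_add_one ha0.ne', Real.Gamma_add_one (sub_pos.2 ha).ne']
  field_simp

theorem mem_interior_integrableExpSet (ha : (k : ℝ) / 2 < a) :
    a ∈ interior (integrableExpSet (fun y : Fin k → ℝ => Real.log (radialWeight y)) volume) :=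
  interior_maximal (fun _ ht => integrable_exp_mul_log_radialWeight ht) isOpen_Ioi ha

/-- The spherical law with density proportional to `(1 + ‖y‖²) ^ (-a)`, encoded as an exponential
tilt so that the moments of `log (1 + ‖y‖²)` are derivatives of a cumulant generating function;
the Student law is an affine image of it with `a = (ν + k) / 2`. -/
noncomputable def stdLaw (k : ℕ) (a : ℝ) : Measure (Fin k → ℝ) :=
  volume.tilted fun y => a * Real.log (radialWeight y)

theorem isProbabilityMeasure_stdLaw (ha : (k : ℝ) / 2 < a) : IsProbabilityMeasure (stdLaw k a) :=
  isProbabilityMeasure_tilted (integrable_exp_mul_log_radialWeight ha)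

theorem isSpherical_stdLaw (k : ℕ) (a : ℝ) : IsSpherical (stdLaw k a) :=
  isSpherical_volume.tilted fun r => a * Real.log (1 + r)⁻¹

theorem integral_mul_radialWeight_pow (g : (Fin k → ℝ) → ℝ) (n : ℕ) :
    ∫ y, g y * radialWeight y ^ n ∂stdLaw k a =
      (∫ y, g y * Real.exp ((a + n) * Real.log (radialWeight y))) /
        mgf (fun y : Fin k → ℝ => Real.log (radialWeight y)) volume a := by
  rw [stdLaw, integral_tilted_mul_eq_mgf, ← integral_div]
  refine integral_congr_ae (.of_forall fun y => ?_)
  simp only [add_mul, Real.exp_add, exp_mul_log_radialWeight, Real.rpow_natCast, smul_eq_mul]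
  ring

theorem integral_radialWeight_pow (n : ℕ) :
    ∫ y, radialWeight y ^ n ∂stdLaw k a =
      mgf (fun y : Fin k → ℝ => Real.log (radialWeight y)) volume (a + n) /
        mgf (fun y : Fin k → ℝ => Real.log (radialWeight y)) volume a := by
  simpa only [one_mul, mgf] using integral_mul_radialWeight_pow (a := a) (k := k) (fun _ => 1) n

theorem integral_radialWeight (ha : (k : ℝ) / 2 < a) :
    ∫ y, radialWeight y ∂stdLaw k a = 1 - k / 2 / a := by
  have h := integral_radialWeight_pow (k := k) (a := a) 1
  simpa [mgf_log_radialWeight_add_one ha, (mgf_log_radialWeight_pos ha).ne'] using h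

theorem memLp_radialWeight (ha : (k : ℝ) / 2 < a) : MemLp radialWeight 2 (stdLaw k a) := by
  have := isProbabilityMeasure_stdLaw ha
  exact .of_bound continuous_radialWeight.aestronglyMeasurable 1 <| .of_forall fun y => by
    rw [Real.norm_of_nonneg (radialWeight_pos y).le]
    exact radialWeight_le_one y

theorem memLp_log_radialWeight (ha : (k : ℝ) / 2 < a) :
    MemLp (fun y => Real.log (radialWeight y)) 2 (stdLaw k a) :=
  memLp_tilted_mul (mem_interior_integrableExpSet ha) 2

theorem variance_radialWeight (ha : (k : ℝ) / 2 < a) :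
    Var[radialWeight; stdLaw k a] = k / 2 * (a - k / 2) / (a ^ 2 * (a + 1)) := by
  have := isProbabilityMeasure_stdLaw ha
  have ha0 : 0 < a := lt_of_le_of_lt (by positivity) ha
  have hmgf := (mgf_log_radialWeight_pos ha).ne'
  have hsq : ∫ y, radialWeight y ^ 2 ∂stdLaw k a = (1 - k / 2 / (a + 1)) * (1 - k / 2 / a) := by
    rw [integral_radialWeight_pow, show a + (2 : ℕ) = a + 1 + 1 by push_cast; ring,
      mgf_log_radialWeight_add_one (by linarith), mgf_log_radialWeight_add_one ha, ← mul_assoc,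
      mul_div_cancel_right₀ _ hmgf]
  rw [variance_eq_sub (memLp_radialWeight ha), integral_radialWeight ha]
  simp only [Pi.pow_apply, hsq]
  field_simp
  ring

theorem hasDerivAt_integral_log_radialWeight (ha : (k : ℝ) / 2 < a) :
    HasDerivAt (fun t => ∫ y, Real.log (radialWeight y) ∂stdLaw k t)
      Var[fun y => Real.log (radialWeight y); stdLaw k a] a := by
  have hmean : (fun t => ∫ y, Real.log (radialWeight y) ∂stdLaw k t) =ᶠ[𝓝 a]
      iteratedDeriv 1 (cgf (fun y : Fin k → ℝ => Real.log (radialWeight y)) volume) := by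
    filter_upwards [eventually_gt_nhds ha] with t ht
    rw [iteratedDeriv_one]
    exact integral_tilted_mul_self (mem_interior_integrableExpSet ht)
  have hcgf := (analyticAt_cgf (mem_interior_integrableExpSet ha)).deriv.differentiableAt.hasDerivAt
  rw [← iteratedDeriv_one, ← iteratedDeriv_succ, one_add_one_eq_two,
    ← variance_tilted_mul (mem_interior_integrableExpSet ha)] at hcgf
  exact hcgf.congr_of_eventuallyEq hmean

theorem covariance_log_radialWeight_radialWeight (ha : (k : ℝ) / 2 < a) :
    cov[fun y => Real.log (radialWeight y), radialWeight; stdLaw k a] = k / 2 / a ^ 2 := by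
  have := isProbabilityMeasure_stdLaw ha
  have ha0 : 0 < a := lt_of_le_of_lt (by positivity) ha
  have hderiv : HasDerivAt
      (fun t => mgf (fun y : Fin k → ℝ => Real.log (radialWeight y)) volume (t + 1)) _ a :=
    (hasDerivAt_mgf (mem_interior_integrableExpSet (by linarith))).comp_add_const a 1
  have hderiv' := (((hasDerivAt_inv ha0.ne').const_mul ((k : ℝ) / 2)).const_sub 1).mul
    (hasDerivAt_mgf (mem_interior_integrableExpSet ha))
  have hrec := hderiv.unique <| hderiv'.congr_of_eventuallyEq <|
    (eventually_gt_nhds ha).mono fun t ht => mgf_log_radialWeight_add_one ht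
  have hmean := integral_mul_radialWeight_pow (a := a) (k := k) (fun y => Real.log (radialWeight y))
  have hX := hmean 0
  have hXB := hmean 1
  simp only [pow_one, pow_zero, mul_one, Nat.cast_one, Nat.cast_zero, add_zero] at hX hXB
  rw [covariance_eq_sub (memLp_log_radialWeight ha) (memLp_radialWeight ha),
    integral_radialWeight ha]
  simp only [Pi.mul_apply]
  rw [hXB, hX, hrec]
  have := (mgf_log_radialWeight_pos ha).ne'
  field_simp
  ring

end RadialPowerLaw

section AffineImage

variable {ι : Type*} [Fintype ι] [DecidableEq ι]

open scoped MatrixOrder Matrix.Norms.L2Operator in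
theorem exists_mul_transpose_eq {S : Matrix ι ι ℝ} (hS : S.PosDef) :
    ∃ T : Matrix ι ι ℝ, T.det ≠ 0 ∧ T * Tᵀ = S := by
  obtain ⟨B, hB⟩ := CStarAlgebra.nonneg_iff_eq_star_mul_self.mp hS.posSemidef.nonneg
  have hB' : Bᵀ * Bᵀᵀ = S := by
    rw [hB, Matrix.transpose_transpose, Matrix.star_eq_conjTranspose,
      Matrix.conjTranspose_eq_transpose_of_trivial]
  refine ⟨Bᵀ, fun h => hS.det_pos.ne' ?_, hB'⟩
  rw [← hB', Matrix.det_mul, h, zero_mul]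

theorem measurableEmbedding_add_mulVec (m : ι → ℝ) {T : Matrix ι ι ℝ} (hT : T.det ≠ 0) :
    MeasurableEmbedding fun y : ι → ℝ => m + T *ᵥ y :=
  (continuous_const.add (continuous_const.matrix_mulVec continuous_id)).measurableEmbedding
    ((add_right_injective m).comp
      (Matrix.mulVec_injective_of_isUnit
        ((Matrix.isUnit_iff_isUnit_det T).2 (isUnit_iff_ne_zero.2 hT))))

theorem lintegral_comp_add_mulVec (m : ι → ℝ) {T : Matrix ι ι ℝ}
    (hT : T.det ≠ 0) {g : (ι → ℝ) → ENNReal} (hg : Measurable g) :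
    ∫⁻ x, g x = ENNReal.ofReal |T.det| * ∫⁻ y, g (m + T *ᵥ y) := by
  have hmeas : Measurable (Matrix.toLin' T) :=
    (LinearMap.continuous_of_finiteDimensional (Matrix.toLin' T)).measurable
  have hmap : ∫⁻ y, g (m + T *ᵥ y) = ∫⁻ y, g (m + y) ∂(volume.map (Matrix.toLin' T)) :=
    (lintegral_map (f := fun y => g (m + y)) (hg.comp (measurable_const_add m)) hmeas).symm
  rw [hmap, Real.map_matrix_volume_pi_eq_smul_volume_pi hT, lintegral_smul_measure,
    lintegral_add_left_eq_self g m, smul_eq_mul, ← mul_assoc, ← ENNReal.ofReal_mul (abs_nonneg _),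
    ← abs_mul, mul_inv_cancel₀ hT, abs_one, ENNReal.ofReal_one, one_mul]

theorem transpose_mul_inv_mul_eq {S T : Matrix ι ι ℝ} {c : ℝ} (hT : T.det ≠ 0)
    (hTS : T * Tᵀ = c • S) : Tᵀ * S⁻¹ * T = c • 1 := by
  have hT' : IsUnit T.det := isUnit_iff_ne_zero.2 hT
  have hinv : S⁻¹ = c • (Tᵀ⁻¹ * T⁻¹) := by
    refine Matrix.inv_eq_right_inv ?_
    rw [Matrix.mul_smul, ← Matrix.smul_mul, ← hTS, Matrix.mul_assoc,
      Matrix.mul_nonsing_inv_cancel_left _ _ (by rwa [Matrix.det_transpose]),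
      Matrix.mul_nonsing_inv _ hT']
  rw [hinv, Matrix.mul_smul, Matrix.smul_mul,
    Matrix.mul_nonsing_inv_cancel_left _ _ (by rwa [Matrix.det_transpose]),
    Matrix.nonsing_inv_mul _ hT']

end AffineImage

section Law

variable {k : ℕ} {μ : Fin k → ℝ} {S : Matrix (Fin k) (Fin k) ℝ} {ν : ℝ}

theorem mahalanobisSq_nonneg (hS : S.PosDef) (μ x : Fin k → ℝ) : 0 ≤ mahalanobisSq μ S x := by
  simpa [mahalanobisSq] using hS.inv.posSemidef.dotProduct_mulVec_nonneg (x - μ)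

@[fun_prop]
theorem continuous_mahalanobisSq (μ : Fin k → ℝ) (S : Matrix (Fin k) (Fin k) ℝ) :
    Continuous (mahalanobisSq μ S) := by
  unfold mahalanobisSq
  fun_prop

/-- The bounded factor `(1 + (x - μ)' S⁻¹ (x - μ) / ν)⁻¹` whose power `(ν + k) / 2` is the Student
density up to a constant. -/
noncomputable def studentWeight (μ : Fin k → ℝ) (S : Matrix (Fin k) (Fin k) ℝ) (ν : ℝ)
    (x : Fin k → ℝ) : ℝ :=
  (1 + mahalanobisSq μ S x / ν)⁻¹

theorem one_add_mahalanobisSq_div_pos (hS : S.PosDef) (hν : 0 < ν) (μ x : Fin k → ℝ) :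
    0 < 1 + mahalanobisSq μ S x / ν :=
  add_pos_of_pos_of_nonneg one_pos (div_nonneg (mahalanobisSq_nonneg hS μ x) hν.le)

theorem continuous_studentWeight (hS : S.PosDef) (hν : 0 < ν) (μ : Fin k → ℝ) :
    Continuous (studentWeight μ S ν) :=
  Continuous.inv₀ (by fun_prop) fun x => (one_add_mahalanobisSq_div_pos hS hν μ x).ne'

theorem mahalanobisSq_add_mulVec {T : Matrix (Fin k) (Fin k) ℝ} (hT : T.det ≠ 0)
    (hTS : T * Tᵀ = ν • S) (μ y : Fin k → ℝ) :
    mahalanobisSq μ S (μ + T *ᵥ y) = ν * (y ⬝ᵥ y) := by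
  rw [mahalanobisSq, add_sub_cancel_left, Matrix.mulVec_mulVec, Matrix.dotProduct_mulVec,
    Matrix.vecMul_mulVec, ← Matrix.dotProduct_mulVec, ← Matrix.mul_assoc,
    transpose_mul_inv_mul_eq hT hTS, Matrix.smul_mulVec, Matrix.one_mulVec, dotProduct_smul,
    smul_eq_mul]

theorem studentWeight_add_mulVec (hν : ν ≠ 0) {T : Matrix (Fin k) (Fin k) ℝ} (hT : T.det ≠ 0)
    (hTS : T * Tᵀ = ν • S) (μ y : Fin k → ℝ) :
    studentWeight μ S ν (μ + T *ᵥ y) = radialWeight y := by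
  rw [studentWeight, radialWeight, mahalanobisSq_add_mulVec hT hTS, mul_div_cancel_left₀ _ hν]

theorem half_lt_half_add (k : ℕ) (hν : 0 < ν) : (k : ℝ) / 2 < (ν + k) / 2 := by linarith

theorem normConst_eq_inv_mul_mgf (k : ℕ) (hν : 0 < ν) :
    normConst k ν = (ν ^ ((k : ℝ) / 2) *
      mgf (fun y : Fin k → ℝ => Real.log (radialWeight y)) volume ((ν + k) / 2))⁻¹ := by
  rw [normConst, mgf_log_radialWeight (half_lt_half_add k hν), add_div, add_sub_cancel_right,
    Real.mul_rpow Real.pi_pos.le hν.le]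
  have := Real.Gamma_pos_of_pos (half_pos hν)
  have := Real.Gamma_pos_of_pos (show 0 < ν / 2 + k / 2 by positivity)
  field_simp

theorem density_eq_mul_exp (hS : S.PosDef) (hν : 0 < ν) (μ x : Fin k → ℝ) :
    density μ S ν x = normConst k ν * S.det ^ (-(1 / 2) : ℝ) *
      Real.exp ((ν + k) / 2 * Real.log (studentWeight μ S ν x)) := by
  have h := one_add_mahalanobisSq_div_pos hS hν μ x
  rw [density, Real.rpow_def_of_pos h, studentWeight, Real.log_inv]
  ring_nf

theorem abs_det_eq_rpow_mul_rpow (hS : S.PosDef) (hν : 0 < ν) {T : Matrix (Fin k) (Fin k) ℝ}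
    (hTS : T * Tᵀ = ν • S) : |T.det| = ν ^ ((k : ℝ) / 2) * S.det ^ (1 / 2 : ℝ) := by
  have h := congrArg Matrix.det hTS
  rw [Matrix.det_mul, Matrix.det_transpose, Matrix.det_smul, Fintype.card_fin] at h
  rw [← Real.sqrt_mul_self_eq_abs, h, Real.sqrt_eq_rpow, Real.mul_rpow (by positivity)
    hS.det_pos.le, ← Real.rpow_natCast, ← Real.rpow_mul hν.le, mul_one_div]

theorem abs_det_mul_density (hS : S.PosDef) (hν : 0 < ν) {T : Matrix (Fin k) (Fin k) ℝ}
    (hT : T.det ≠ 0) (hTS : T * Tᵀ = ν • S) (μ y : Fin k → ℝ) :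
    |T.det| * density μ S ν (μ + T *ᵥ y) =
      Real.exp ((ν + k) / 2 * Real.log (radialWeight y)) /
        mgf (fun y : Fin k → ℝ => Real.log (radialWeight y)) volume ((ν + k) / 2) := by
  have hmgf := mgf_log_radialWeight_pos (half_lt_half_add k hν)
  have hdet := Real.rpow_pos_of_pos hS.det_pos (1 / 2)
  have := Real.rpow_pos_of_pos hν (k / 2)
  rw [density_eq_mul_exp hS hν, studentWeight_add_mulVec hν.ne' hT hTS,
    abs_det_eq_rpow_mul_rpow hS hν hTS, normConst_eq_inv_mul_mgf k hν, Real.rpow_neg hS.det_pos.le]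
  field_simp

theorem continuous_density (hS : S.PosDef) (hν : 0 < ν) (μ : Fin k → ℝ) :
    Continuous (density μ S ν) :=
  (Continuous.rpow_const (by fun_prop) fun x =>
    .inl (one_add_mahalanobisSq_div_pos hS hν μ x).ne').const_mul _

theorem measurePreserving_add_mulVec (hS : S.PosDef) (hν : 0 < ν) {T : Matrix (Fin k) (Fin k) ℝ}
    (hT : T.det ≠ 0) (hTS : T * Tᵀ = ν • S) (μ : Fin k → ℝ) :
    MeasurePreserving (fun y => μ + T *ᵥ y) (stdLaw k ((ν + k) / 2)) (law μ S ν) := by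
  have hmeas := (measurableEmbedding_add_mulVec μ hT).measurable
  refine ⟨hmeas, ?_⟩
  ext s hs
  rw [Measure.map_apply hmeas hs, law, withDensity_apply _ hs, stdLaw,
    tilted_mul_apply_mgf _ (X := fun y => Real.log (radialWeight y)), ← lintegral_indicator hs,
    ← lintegral_indicator (hmeas hs), lintegral_comp_add_mulVec μ hT
      ((continuous_density hS hν μ).measurable.ennreal_ofReal.indicator hs),
    ← lintegral_const_mul' _ _ ENNReal.ofReal_ne_top]
  refine lintegral_congr fun y => ?_
  classical simp only [Set.indicator_apply, Set.mem_preimage, mul_ite, mul_zero,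
    ← ENNReal.ofReal_mul (abs_nonneg T.det), abs_det_mul_density hS hν hT hTS]

theorem exists_measurePreserving_add_mulVec (hS : S.PosDef) (hν : 0 < ν) (μ : Fin k → ℝ) :
    ∃ T : Matrix (Fin k) (Fin k) ℝ, T.det ≠ 0 ∧ T * Tᵀ = ν • S ∧
      MeasurePreserving (fun y => μ + T *ᵥ y) (stdLaw k ((ν + k) / 2)) (law μ S ν) := by
  obtain ⟨T, hT, hTS⟩ := exists_mul_transpose_eq (hS.smul hν)
  exact ⟨T, hT, hTS, measurePreserving_add_mulVec hS hν hT hTS μ⟩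

theorem isProbabilityMeasure_law (hS : S.PosDef) (hν : 0 < ν) (μ : Fin k → ℝ) :
    IsProbabilityMeasure (law μ S ν) := by
  obtain ⟨T, -, -, hmp⟩ := exists_measurePreserving_add_mulVec hS hν μ
  have := isProbabilityMeasure_stdLaw (half_lt_half_add k hν)
  rw [← hmp.map_eq]
  exact Measure.isProbabilityMeasure_map hmp.measurable.aemeasurable

theorem identDistrib_studentWeight (hS : S.PosDef) (hν : 0 < ν) (μ : Fin k → ℝ) :
    IdentDistrib (studentWeight μ S ν) radialWeight (law μ S ν) (stdLaw k ((ν + k) / 2)) := by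
  obtain ⟨T, hT, hTS, hmp⟩ := exists_measurePreserving_add_mulVec hS hν μ
  have hmeas := (continuous_studentWeight hS hν μ).measurable
  refine ⟨hmeas.aemeasurable, continuous_radialWeight.measurable.aemeasurable, ?_⟩
  rw [← hmp.map_eq, Measure.map_map hmeas hmp.measurable]
  exact congrArg (Measure.map · _) (funext fun y => studentWeight_add_mulVec hν.ne' hT hTS μ y)

theorem covariance_comp_studentWeight (hS : S.PosDef) (hν : 0 < ν) (μ : Fin k → ℝ) {f g : ℝ → ℝ}
    (hf : Measurable f) (hg : Measurable g) :
    cov[fun x => f (studentWeight μ S ν x), fun x => g (studentWeight μ S ν x); law μ S ν] =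
      cov[fun y => f (radialWeight y), fun y => g (radialWeight y); stdLaw k ((ν + k) / 2)] := by
  have h := identDistrib_studentWeight hS hν μ
  rw [← covariance_map_fun hf.aestronglyMeasurable hg.aestronglyMeasurable h.aemeasurable_fst,
    h.map_eq, covariance_map_fun hf.aestronglyMeasurable hg.aestronglyMeasurable
      h.aemeasurable_snd]

theorem integral_law_eq_zero_of_odd (hS : S.PosDef) (hν : 0 < ν) {f : (Fin k → ℝ) → ℝ}
    (hf : ∀ z, f (μ - z) = -f (μ + z)) : ∫ x, f x ∂law μ S ν = 0 := by
  obtain ⟨T, hT, -, hmp⟩ := exists_measurePreserving_add_mulVec hS hν μ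
  rw [← hmp.integral_comp (measurableEmbedding_add_mulVec μ hT)]
  refine (isSpherical_stdLaw k _).integral_eq_zero_of_odd fun y => ?_
  rw [Matrix.mulVec_neg, ← sub_eq_add_neg, hf]

theorem integral_law_dotProduct_mulVec (hS : S.PosDef) (hν : 0 < ν) {φ : ℝ → ℝ}
    (hφ : Measurable φ)
    (hint : Integrable (fun x => mahalanobisSq μ S x * φ (mahalanobisSq μ S x)) (law μ S ν))
    (D : Matrix (Fin k) (Fin k) ℝ) :
    ∫ x, ((x - μ) ⬝ᵥ (D *ᵥ (x - μ))) * φ (mahalanobisSq μ S x) ∂law μ S ν =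
      (D * S).trace / k * ∫ x, mahalanobisSq μ S x * φ (mahalanobisSq μ S x) ∂law μ S ν := by
  obtain ⟨T, hT, hTS, hmp⟩ := exists_measurePreserving_add_mulVec hS hν μ
  have hemb := measurableEmbedding_add_mulVec μ hT
  rw [← hmp.integrable_comp_emb hemb] at hint
  have htrace : (Tᵀ * D * T).trace = ν * (D * S).trace := by
    rw [Matrix.trace_mul_comm, ← Matrix.mul_assoc, hTS, Matrix.smul_mul, Matrix.trace_smul,
      Matrix.trace_mul_comm, smul_eq_mul]
  have hquad (y : Fin k → ℝ) : (T *ᵥ y) ⬝ᵥ (D *ᵥ (T *ᵥ y)) = y ⬝ᵥ ((Tᵀ * D * T) *ᵥ y) := by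
    rw [Matrix.mulVec_mulVec, Matrix.dotProduct_mulVec, Matrix.vecMul_mulVec,
      ← Matrix.dotProduct_mulVec, ← Matrix.mul_assoc]
  rw [← hmp.integral_comp hemb, ← hmp.integral_comp hemb]
  simp only [Function.comp_def, mahalanobisSq_add_mulVec hT hTS, add_sub_cancel_left,
    hquad, mul_assoc, integral_const_mul] at hint ⊢
  rw [(isSpherical_stdLaw k _).integral_dotProduct_mulVec (φ := fun r => φ (ν * r)) (by fun_prop)
    ((integrable_const_mul_iff (IsUnit.mk0 _ hν.ne') _).1 hint), ← Matrix.mul_assoc, htrace,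
    Fintype.card_fin]
  ring

end Law

section MatrixCalculus

variable {ι : Type*} [Fintype ι] [DecidableEq ι] {S : Matrix ι ι ℝ}

theorem hasDerivAt_det_add_smul (hS : S.det ≠ 0) (E : Matrix ι ι ℝ) :
    HasDerivAt (fun t : ℝ => (S + t • E).det) (S.det * (S⁻¹ * E).trace) 0 := by
  set P := (Matrix.det (1 + (Polynomial.X : Polynomial ℝ) •
    (S⁻¹ * E).map Polynomial.C)).divX.divX
  have hexpand (t : ℝ) :
      (S + t • E).det = S.det * (1 + (S⁻¹ * E).trace * t + P.eval t * t ^ 2) := by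
    rw [← Matrix.det_one_add_smul, ← Matrix.det_mul, Matrix.mul_add, Matrix.mul_one,
      Matrix.mul_smul, Matrix.mul_nonsing_inv_cancel_left _ _ (isUnit_iff_ne_zero.2 hS)]
  have h := (((hasDerivAt_id (0 : ℝ)).const_mul (S⁻¹ * E).trace).const_add 1).add
    ((P.hasDerivAt 0).mul ((hasDerivAt_id (0 : ℝ)).pow 2))
  simp_rw [hexpand]
  exact (h.const_mul S.det).congr_deriv (by simp)

open scoped Matrix.Norms.Operator

theorem hasFDerivAt_matrix_inv (hS : S.det ≠ 0) :
    HasFDerivAt (fun A : Matrix ι ι ℝ => A⁻¹)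
      (-ContinuousLinearMap.mulLeftRight ℝ (Matrix ι ι ℝ) S⁻¹ S⁻¹) S := by
  obtain ⟨u, rfl⟩ : IsUnit S := (Matrix.isUnit_iff_isUnit_det S).2 (isUnit_iff_ne_zero.2 hS)
  simpa only [Matrix.nonsing_inv_eq_ringInverse, Ring.inverse_unit] using
    hasFDerivAt_ringInverse (𝕜 := ℝ) u

end MatrixCalculus

section Mahalanobis

variable {k : ℕ} {S : Matrix (Fin k) (Fin k) ℝ}

open scoped Matrix.Norms.Operator

/-- The derivative of `(μ, S) ↦ (x - μ)' S⁻¹ (x - μ)` at a symmetric invertible `S`, as a function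
of the direction. -/
noncomputable def mahalanobisSqDeriv (μ : Fin k → ℝ) (S : Matrix (Fin k) (Fin k) ℝ)
    (x : Fin k → ℝ) : (Fin k → ℝ) × Matrix (Fin k) (Fin k) ℝ →L[ℝ] ℝ :=
  LinearMap.toContinuousLinearMap
    { toFun := fun v =>
        -((x - μ) ⬝ᵥ ((S⁻¹ * v.2 * S⁻¹) *ᵥ (x - μ))) - 2 * (v.1 ⬝ᵥ (S⁻¹ *ᵥ (x - μ)))
      map_add' := fun v w => by
        simp only [Prod.fst_add, Prod.snd_add, Matrix.mul_add, Matrix.add_mul, Matrix.add_mulVec,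
          dotProduct_add, add_dotProduct]
        ring
      map_smul' := fun c v => by
        simp only [Prod.smul_fst, Prod.smul_snd, Matrix.mul_smul, Matrix.smul_mul,
          Matrix.smul_mulVec, dotProduct_smul, smul_dotProduct, smul_eq_mul, RingHom.id_apply]
        ring }

theorem mahalanobisSqDeriv_apply (μ : Fin k → ℝ) (S : Matrix (Fin k) (Fin k) ℝ) (x : Fin k → ℝ)
    (v : (Fin k → ℝ) × Matrix (Fin k) (Fin k) ℝ) :
    mahalanobisSqDeriv μ S x v =
      -((x - μ) ⬝ᵥ ((S⁻¹ * v.2 * S⁻¹) *ᵥ (x - μ))) - 2 * (v.1 ⬝ᵥ (S⁻¹ *ᵥ (x - μ))) :=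
  rfl

theorem hasFDerivAt_mahalanobisSq (hS : S.det ≠ 0) (hsymm : S.IsSymm) (μ x : Fin k → ℝ) :
    HasFDerivAt (fun θ : (Fin k → ℝ) × Matrix (Fin k) (Fin k) ℝ => mahalanobisSq θ.1 θ.2 x)
      (mahalanobisSqDeriv μ S x) (μ, S) := by
  let B := (dotProductBilin ℝ ℝ (m := Fin k) (A := ℝ)).toContinuousBilinearMap
  let M := (Matrix.mulVecBilin ℝ ℝ (m := Fin k) (n := Fin k) (A := ℝ)).toContinuousBilinearMap
  have hz : HasFDerivAt (fun θ : (Fin k → ℝ) × Matrix (Fin k) (Fin k) ℝ => x - θ.1)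
      (-ContinuousLinearMap.fst ℝ _ _) (μ, S) := hasFDerivAt_fst.const_sub x
  have hinv : HasFDerivAt (fun θ : (Fin k → ℝ) × Matrix (Fin k) (Fin k) ℝ => θ.2⁻¹) _ (μ, S) :=
    (hasFDerivAt_matrix_inv hS).comp (μ, S) hasFDerivAt_snd
  refine (B.hasFDerivAt_of_bilinear hz (M.hasFDerivAt_of_bilinear hinv hz)).congr_fderiv ?_
  refine ContinuousLinearMap.ext fun v => ?_
  have hcomm (m : Fin k → ℝ) : (x - μ) ⬝ᵥ (S⁻¹ *ᵥ m) = m ⬝ᵥ (S⁻¹ *ᵥ (x - μ)) := by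
    rw [← Matrix.dotProduct_transpose_mulVec, hsymm.inv.eq, dotProduct_comm]
  change (x - μ) ⬝ᵥ (S⁻¹ *ᵥ (-v.1) + (-(S⁻¹ * v.2 * S⁻¹)) *ᵥ (x - μ)) +
    (-v.1) ⬝ᵥ (S⁻¹ *ᵥ (x - μ)) =
      -((x - μ) ⬝ᵥ ((S⁻¹ * v.2 * S⁻¹) *ᵥ (x - μ))) - 2 * (v.1 ⬝ᵥ (S⁻¹ *ᵥ (x - μ)))
  rw [dotProduct_add, hcomm, Matrix.neg_mulVec, dotProduct_neg, neg_dotProduct]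
  ring

end Mahalanobis

section Vech

variable {k : ℕ}

theorem unvech_vech {S : Matrix (Fin k) (Fin k) ℝ} (hS : S.IsSymm) : unvech (vech S) = S := by
  ext i j
  rcases le_total i j with h | h
  · simp [unvech, vech, h]
  · simpa [unvech, vech, h] using hS.apply i j

theorem vech_unvech (s : VechIdx k → ℝ) : vech (unvech s) = s := by
  ext ⟨⟨i, j⟩, h : i ≤ j⟩
  simp [unvech, vech, h]

theorem unvech_isSymm (s : VechIdx k → ℝ) : (unvech s).IsSymm := by
  ext i j
  simp [unvech, min_comm, max_comm]

theorem unvech_add_smul (r s : VechIdx k → ℝ) (t : ℝ) :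
    unvech (r + t • s) = unvech r + t • unvech s :=
  rfl

theorem sum_smul_unvech_single (s : VechIdx k → ℝ) :
    ∑ p, s p • unvech (Pi.single p 1) = unvech s := by
  ext i j
  simp [unvech, Matrix.sum_apply, Pi.single_apply]

end Vech

section Scores

variable {k : ℕ} {S : Matrix (Fin k) (Fin k) ℝ} {ν : ℝ}

theorem isSymm_of_posDef (hS : S.PosDef) : S.IsSymm := by
  simpa only [Matrix.IsSymm, Matrix.IsHermitian,
    Matrix.conjTranspose_eq_transpose_of_trivial] using hS.isHermitian

theorem log_normConst (k : ℕ) (hν : 0 < ν) :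
    Real.log (normConst k ν) = -(k / 2 * Real.log ν +
      cgf (fun y : Fin k → ℝ => Real.log (radialWeight y)) volume ((ν + k) / 2)) := by
  have hmgf := mgf_log_radialWeight_pos (half_lt_half_add k hν)
  rw [normConst_eq_inv_mul_mgf k hν, Real.log_inv, Real.log_mul (by positivity) hmgf.ne',
    Real.log_rpow hν, cgf]

theorem log_density (hν : 0 < ν) (hdet : 0 < S.det) {μ x : Fin k → ℝ}
    (hx : 0 < 1 + mahalanobisSq μ S x / ν) :
    Real.log (density μ S ν x) = -(k / 2 * Real.log ν +
      cgf (fun y : Fin k → ℝ => Real.log (radialWeight y)) volume ((ν + k) / 2)) -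
        1 / 2 * Real.log S.det - (ν + k) / 2 * Real.log (1 + mahalanobisSq μ S x / ν) := by
  have hmgf := mgf_log_radialWeight_pos (half_lt_half_add k hν)
  have hc : 0 < normConst k ν := by
    rw [normConst_eq_inv_mul_mgf k hν]
    positivity
  rw [density, Real.log_mul (by positivity) (by positivity),
    Real.log_mul (by positivity) (by positivity), Real.log_rpow hdet, Real.log_rpow hx,
    log_normConst k hν]
  ring

open scoped Matrix.Norms.Operator in
theorem hasDerivAt_mahalanobisSq_add_smul (hdet : S.det ≠ 0) (hS : S.IsSymm) (μ x : Fin k → ℝ)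
    (E : Matrix (Fin k) (Fin k) ℝ) :
    HasDerivAt (fun t : ℝ => mahalanobisSq μ (S + t • E) x)
      (-((x - μ) ⬝ᵥ ((S⁻¹ * E * S⁻¹) *ᵥ (x - μ)))) 0 := by
  have hline : HasDerivAt (fun t : ℝ => (μ, S + t • E)) (0, E) 0 :=
    (hasDerivAt_const 0 μ).prodMk
      (by simpa using ((hasDerivAt_id (0 : ℝ)).smul_const E).const_add S)
  have h : HasFDerivAt (fun θ : (Fin k → ℝ) × Matrix (Fin k) (Fin k) ℝ =>
      mahalanobisSq θ.1 θ.2 x) (mahalanobisSqDeriv μ S x) (μ, S + (0 : ℝ) • E) := by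
    simpa only [zero_smul, add_zero] using hasFDerivAt_mahalanobisSq hdet hS μ x
  refine (h.comp_hasDerivAt (0 : ℝ) hline).congr_deriv
    ((mahalanobisSqDeriv_apply μ S x (0, E)).trans ?_)
  rw [zero_dotProduct, mul_zero, sub_zero]

theorem hasDerivAt_log_density_add_smul (hS : S.PosDef) (hν : 0 < ν) (μ x : Fin k → ℝ)
    (E : Matrix (Fin k) (Fin k) ℝ) :
    HasDerivAt (fun t : ℝ => Real.log (density μ (S + t • E) ν x))
      ((ν + k) / 2 / ν * (((x - μ) ⬝ᵥ ((S⁻¹ * E * S⁻¹) *ᵥ (x - μ))) * studentWeight μ S ν x) -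
        1 / 2 * (S⁻¹ * E).trace) 0 := by
  have hS0 : S + (0 : ℝ) • E = S := by rw [zero_smul, add_zero]
  have hdet := hasDerivAt_det_add_smul hS.det_pos.ne' E
  have hbase := ((hasDerivAt_mahalanobisSq_add_smul hS.det_pos.ne' (isSymm_of_posDef hS) μ x
    E).div_const ν).const_add 1
  have hx := one_add_mahalanobisSq_div_pos hS hν μ x
  have hsum := (((hdet.log (by rw [hS0]; exact hS.det_pos.ne')).const_mul (1 / 2)).const_sub
    (-(k / 2 * Real.log ν +
      cgf (fun y : Fin k → ℝ => Real.log (radialWeight y)) volume ((ν + k) / 2)))).sub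
        ((hbase.log (by rw [hS0]; exact hx.ne')).const_mul ((ν + k) / 2))
  refine (hsum.congr_of_eventuallyEq ?_).congr_deriv ?_
  · filter_upwards [hdet.continuousAt.eventually_const_lt (by simpa only [hS0] using hS.det_pos),
      hbase.continuousAt.eventually_const_lt (by simpa only [hS0] using hx)] with t hdet_t hx_t
    exact log_density hν hdet_t hx_t
  rw [hS0, mul_div_cancel_left₀ _ hS.det_pos.ne', studentWeight]
  ring

theorem scoreScatter_apply (hS : S.PosDef) (hν : 0 < ν) (μ x : Fin k → ℝ) (p : VechIdx k) :
    scoreScatter μ S ν x p = (ν + k) / 2 / ν *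
      (((x - μ) ⬝ᵥ ((S⁻¹ * unvech (Pi.single p 1) * S⁻¹) *ᵥ (x - μ))) * studentWeight μ S ν x) -
        1 / 2 * (S⁻¹ * unvech (Pi.single p 1)).trace := by
  rw [← (hasDerivAt_log_density_add_smul hS hν μ x (unvech (Pi.single p 1))).deriv, scoreScatter,
    lineDeriv]
  simp only [unvech_add_smul, unvech_vech (isSymm_of_posDef hS)]

theorem dotProduct_scoreScatter (hS : S.PosDef) (hν : 0 < ν) (μ x : Fin k → ℝ)
    (s : VechIdx k → ℝ) :
    s ⬝ᵥ scoreScatter μ S ν x = (ν + k) / 2 / ν *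
      (((x - μ) ⬝ᵥ ((S⁻¹ * unvech s * S⁻¹) *ᵥ (x - μ))) * studentWeight μ S ν x) -
        1 / 2 * (S⁻¹ * unvech s).trace := by
  rw [← sum_smul_unvech_single s, Matrix.mul_sum, Matrix.sum_mul, Matrix.sum_mulVec,
    dotProduct_sum, Matrix.trace_sum, Finset.sum_mul, Finset.mul_sum, Finset.mul_sum,
    ← Finset.sum_sub_distrib]
  refine Finset.sum_congr rfl fun p _ => ?_
  simp only [scoreScatter_apply hS hν, Matrix.mul_smul, Matrix.smul_mul, Matrix.smul_mulVec,
    dotProduct_smul, Matrix.trace_smul, smul_eq_mul]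
  ring

theorem mahalanobisSq_mul_studentWeight (hS : S.PosDef) (hν : 0 < ν) (μ x : Fin k → ℝ) :
    mahalanobisSq μ S x * studentWeight μ S ν x = ν * (1 - studentWeight μ S ν x) := by
  have hd := mahalanobisSq_nonneg hS μ x
  rw [studentWeight]
  field_simp
  ring

theorem vech_dotProduct_scoreScatter (hS : S.PosDef) (hν : 0 < ν) (μ x : Fin k → ℝ) :
    vech S ⬝ᵥ scoreScatter μ S ν x =
      -((ν + k) / 2 * (studentWeight μ S ν x - ν / (ν + k))) := by
  have hdet : IsUnit S.det := isUnit_iff_ne_zero.2 hS.det_pos.ne'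
  have : 0 < ν + k := by positivity
  rw [dotProduct_scoreScatter hS hν, unvech_vech (isSymm_of_posDef hS),
    Matrix.nonsing_inv_mul _ hdet, Matrix.one_mul, Matrix.trace_one, Fintype.card_fin,
    ← mahalanobisSq, mahalanobisSq_mul_studentWeight hS hν]
  field_simp
  ring

theorem scoreTail_eq (hS : S.PosDef) (hν : 0 < ν) (μ x : Fin k → ℝ) :
    scoreTail μ S ν x = 1 / 2 * (Real.log (studentWeight μ S ν x) -
        ∫ y, Real.log (radialWeight y) ∂stdLaw k ((ν + k) / 2)) -
      (ν + k) / 2 / ν * (studentWeight μ S ν x - ν / (ν + k)) := by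
  set d := mahalanobisSq μ S x with hd
  have hd0 : 0 ≤ d := mahalanobisSq_nonneg hS μ x
  have hx := one_add_mahalanobisSq_div_pos hS hν μ x
  have hhalf : HasDerivAt (fun v : ℝ => (v + k) / 2) (1 / 2) ν :=
    ((hasDerivAt_id ν).add_const (k : ℝ)).div_const 2
  have hint := mem_interior_integrableExpSet (half_lt_half_add k hν)
  have hcgf := (analyticAt_cgf hint).differentiableAt.hasDerivAt
  rw [← integral_tilted_mul_self hint, ← stdLaw] at hcgf
  have hbase : HasDerivAt (fun v : ℝ => 1 + d / v) (d * -(ν ^ 2)⁻¹) ν := by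
    simpa only [div_eq_mul_inv] using ((hasDerivAt_inv hν.ne').const_mul d).const_add 1
  have hsum := ((((Real.hasDerivAt_log hν.ne').const_mul ((k : ℝ) / 2)).add
    (hcgf.comp ν hhalf)).neg.sub_const (1 / 2 * Real.log S.det)).sub
      (hhalf.mul (hbase.log hx.ne'))
  have hderiv := hsum.congr_of_eventuallyEq (f₁ := fun v => Real.log (density μ S v x)) (by
    filter_upwards [eventually_gt_nhds hν] with v hv
    exact log_density hv hS.det_pos (one_add_mahalanobisSq_div_pos hS hv μ x))
  have : 0 < ν + k := by positivity
  rw [scoreTail, hderiv.deriv, studentWeight, Real.log_inv, ← hd]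
  field_simp
  ring

end Scores

section Information

variable {k : ℕ} {μ : Fin k → ℝ} {S : Matrix (Fin k) (Fin k) ℝ} {ν : ℝ}

theorem sub_dotProduct_sub_le (hS : S.PosDef) (μ x : Fin k → ℝ) :
    (x - μ) ⬝ᵥ (x - μ) ≤ S.trace * mahalanobisSq μ S x := by
  obtain ⟨T, hT, hTS⟩ := exists_mul_transpose_eq hS
  obtain ⟨y, rfl⟩ : ∃ y, μ + T *ᵥ y = x := ⟨T⁻¹ *ᵥ (x - μ), by
    rw [Matrix.mulVec_mulVec, Matrix.mul_nonsing_inv _ (isUnit_iff_ne_zero.2 hT),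
      Matrix.one_mulVec, add_sub_cancel]⟩
  rw [mahalanobisSq_add_mulVec (ν := 1) hT (by rwa [one_smul]), one_mul, add_sub_cancel_left,
    ← hTS]
  exact mulVec_dotProduct_mulVec_le T y

theorem studentWeight_pos (hS : S.PosDef) (hν : 0 < ν) (μ x : Fin k → ℝ) :
    0 < studentWeight μ S ν x :=
  inv_pos.2 (one_add_mahalanobisSq_div_pos hS hν μ x)

theorem mahalanobisSq_mul_studentWeight_le (hS : S.PosDef) (hν : 0 < ν) (μ x : Fin k → ℝ) :
    mahalanobisSq μ S x * studentWeight μ S ν x ≤ ν := by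
  rw [mahalanobisSq_mul_studentWeight hS hν]
  nlinarith [studentWeight_pos hS hν μ x]

open scoped Matrix.Norms.Operator in
theorem abs_dotProduct_mulVec_mul_studentWeight_le (hS : S.PosDef) (hν : 0 < ν)
    (D : Matrix (Fin k) (Fin k) ℝ) (μ x : Fin k → ℝ) :
    |((x - μ) ⬝ᵥ (D *ᵥ (x - μ))) * studentWeight μ S ν x| ≤ k * (‖D‖ * (S.trace * ν)) := by
  have hw := studentWeight_pos hS hν μ x
  have htrace := hS.posSemidef.trace_nonneg
  have hquad : |(x - μ) ⬝ᵥ (D *ᵥ (x - μ))| ≤ k * (‖D‖ * (S.trace * mahalanobisSq μ S x)) := by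
    refine (abs_dotProduct_mulVec_le D _ _).trans ?_
    rw [Fintype.card_fin, ← sq]
    gcongr
    exact (norm_sq_le_dotProduct_self _).trans (sub_dotProduct_sub_le hS μ x)
  calc |((x - μ) ⬝ᵥ (D *ᵥ (x - μ))) * studentWeight μ S ν x|
      = |(x - μ) ⬝ᵥ (D *ᵥ (x - μ))| * studentWeight μ S ν x := by rw [abs_mul, abs_of_pos hw]
    _ ≤ k * (‖D‖ * (S.trace * mahalanobisSq μ S x)) * studentWeight μ S ν x := by gcongr
    _ = k * (‖D‖ * (S.trace * (mahalanobisSq μ S x * studentWeight μ S ν x))) := by ring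
    _ ≤ k * (‖D‖ * (S.trace * ν)) := by
        gcongr
        exact mahalanobisSq_mul_studentWeight_le hS hν μ x

theorem continuous_dotProduct_mulVec_mul_studentWeight (hS : S.PosDef) (hν : 0 < ν)
    (D : Matrix (Fin k) (Fin k) ℝ) (μ : Fin k → ℝ) :
    Continuous fun x => ((x - μ) ⬝ᵥ (D *ᵥ (x - μ))) * studentWeight μ S ν x :=
  Continuous.mul (by fun_prop) (continuous_studentWeight hS hν μ)

theorem memLp_dotProduct_mulVec_mul_studentWeight (hS : S.PosDef) (hν : 0 < ν)
    (D : Matrix (Fin k) (Fin k) ℝ) (μ : Fin k → ℝ) :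
    MemLp (fun x => ((x - μ) ⬝ᵥ (D *ᵥ (x - μ))) * studentWeight μ S ν x) 2 (law μ S ν) := by
  have := isProbabilityMeasure_law hS hν μ
  exact .of_bound
    (continuous_dotProduct_mulVec_mul_studentWeight hS hν D μ).aestronglyMeasurable _
    (.of_forall fun x => abs_dotProduct_mulVec_mul_studentWeight_le hS hν D μ x)

theorem memLp_studentWeight (hS : S.PosDef) (hν : 0 < ν) (μ : Fin k → ℝ) :
    MemLp (studentWeight μ S ν) 2 (law μ S ν) :=
  (identDistrib_studentWeight hS hν μ).memLp_iff.2 (memLp_radialWeight (half_lt_half_add k hν))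

theorem memLp_log_studentWeight (hS : S.PosDef) (hν : 0 < ν) (μ : Fin k → ℝ) :
    MemLp (fun x => Real.log (studentWeight μ S ν x)) 2 (law μ S ν) :=
  ((identDistrib_studentWeight hS hν μ).comp Real.measurable_log).memLp_iff.2
    (memLp_log_radialWeight (half_lt_half_add k hν))

theorem covariance_dotProduct_mulVec_mul_studentWeight (hS : S.PosDef) (hν : 0 < ν)
    {g : ℝ → ℝ} (hg : Measurable g)
    (hgw : MemLp (fun x => g (studentWeight μ S ν x)) 2 (law μ S ν))
    (D : Matrix (Fin k) (Fin k) ℝ) :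
    cov[fun x => ((x - μ) ⬝ᵥ (D *ᵥ (x - μ))) * studentWeight μ S ν x,
        fun x => g (studentWeight μ S ν x); law μ S ν] =
      -(ν * ((D * S).trace / k) *
        cov[studentWeight μ S ν, fun x => g (studentWeight μ S ν x); law μ S ν]) := by
  have := isProbabilityMeasure_law hS hν μ
  have hw := memLp_studentWeight hS hν μ
  have hdw : MemLp (fun x => mahalanobisSq μ S x * studentWeight μ S ν x) 2 (law μ S ν) := by
    simp only [mahalanobisSq_mul_studentWeight hS hν]
    exact ((memLp_const 1).sub hw).const_mul ν
  have hquad {φ : ℝ → ℝ} (hφ : Measurable φ) (hφw : Integrable (fun x => mahalanobisSq μ S x *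
        studentWeight μ S ν x * φ (studentWeight μ S ν x)) (law μ S ν)) :
      ∫ x, ((x - μ) ⬝ᵥ (D *ᵥ (x - μ))) * studentWeight μ S ν x *
          φ (studentWeight μ S ν x) ∂law μ S ν =
        (D * S).trace / k * ∫ x, mahalanobisSq μ S x * studentWeight μ S ν x *
          φ (studentWeight μ S ν x) ∂law μ S ν := by
    simp only [mul_assoc] at hφw ⊢
    exact integral_law_dotProduct_mulVec hS hν
      (φ := fun r => (1 + r / ν)⁻¹ * φ (1 + r / ν)⁻¹) (by fun_prop) hφw D
  have hquad_one := hquad (φ := fun _ => 1) measurable_const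
    (by simpa only [mul_one] using hdw.integrable one_le_two)
  simp only [mul_one] at hquad_one
  have hcov : cov[fun x => mahalanobisSq μ S x * studentWeight μ S ν x,
      fun x => g (studentWeight μ S ν x); law μ S ν] =
        -(ν * cov[studentWeight μ S ν, fun x => g (studentWeight μ S ν x); law μ S ν]) := by
    simp only [mahalanobisSq_mul_studentWeight hS hν]
    rw [covariance_const_mul_left, covariance_const_sub_left (hw.integrable one_le_two), mul_neg]
  rw [covariance_eq_sub hdw hgw] at hcov
  rw [covariance_eq_sub (memLp_dotProduct_mulVec_mul_studentWeight hS hν D μ) hgw]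
  simp only [Pi.mul_apply] at hcov ⊢
  rw [hquad hg (hdw.integrable_mul hgw), hquad_one]
  linear_combination (D * S).trace / k * hcov

theorem memLp_scoreScatter (hS : S.PosDef) (hν : 0 < ν) (μ : Fin k → ℝ) (p : VechIdx k) :
    MemLp (fun x => scoreScatter μ S ν x p) 2 (law μ S ν) := by
  have := isProbabilityMeasure_law hS hν μ
  simp only [scoreScatter_apply hS hν]
  exact ((memLp_dotProduct_mulVec_mul_studentWeight hS hν _ μ).const_mul _).sub (memLp_const _)

theorem covariance_scoreScatter_comp_studentWeight (hS : S.PosDef) (hν : 0 < ν)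
    {g : ℝ → ℝ} (hg : Measurable g)
    (hgw : MemLp (fun x => g (studentWeight μ S ν x)) 2 (law μ S ν)) (p : VechIdx k) :
    cov[fun x => scoreScatter μ S ν x p, fun x => g (studentWeight μ S ν x); law μ S ν] =
      -((ν + k) / 2 * ((S⁻¹ * unvech (Pi.single p 1)).trace / k) *
        cov[studentWeight μ S ν, fun x => g (studentWeight μ S ν x); law μ S ν]) := by
  have := isProbabilityMeasure_law hS hν μ
  have hquad := memLp_dotProduct_mulVec_mul_studentWeight hS hν
    (S⁻¹ * unvech (Pi.single p 1) * S⁻¹) μ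
  simp only [scoreScatter_apply hS hν]
  rw [covariance_sub_const_left ((hquad.const_mul _).integrable one_le_two),
    covariance_const_mul_left, covariance_dotProduct_mulVec_mul_studentWeight hS hν hg hgw,
    Matrix.mul_assoc, Matrix.nonsing_inv_mul _ (isUnit_iff_ne_zero.2 hS.det_pos.ne'),
    Matrix.mul_one]
  field_simp

theorem variance_studentWeight (hS : S.PosDef) (hν : 0 < ν) (μ : Fin k → ℝ) :
    Var[studentWeight μ S ν; law μ S ν] = 2 * k * ν / ((ν + k) ^ 2 * (ν + k + 2)) := by
  have : 0 < ν + k := by positivity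
  rw [(identDistrib_studentWeight hS hν μ).variance_eq,
    variance_radialWeight (half_lt_half_add k hν)]
  field_simp
  ring

theorem covariance_log_studentWeight_studentWeight (hS : S.PosDef) (hν : 0 < ν)
    (μ : Fin k → ℝ) :
    cov[fun x => Real.log (studentWeight μ S ν x), studentWeight μ S ν; law μ S ν] =
      2 * k / (ν + k) ^ 2 := by
  have : 0 < ν + k := by positivity
  rw [covariance_comp_studentWeight hS hν μ Real.measurable_log measurable_id',
    covariance_log_radialWeight_radialWeight (half_lt_half_add k hν)]
  field_simp

theorem variance_log_studentWeight (hS : S.PosDef) (hν : 0 < ν) (μ : Fin k → ℝ) :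
    Var[fun x => Real.log (studentWeight μ S ν x); law μ S ν] =
      Var[fun y : Fin k → ℝ => Real.log (radialWeight y); stdLaw k ((ν + k) / 2)] :=
  ((identDistrib_studentWeight hS hν μ).comp Real.measurable_log).variance_eq

theorem memLp_scoreTail (hS : S.PosDef) (hν : 0 < ν) (μ : Fin k → ℝ) :
    MemLp (scoreTail μ S ν) 2 (law μ S ν) := by
  have := isProbabilityMeasure_law hS hν μ
  rw [funext (scoreTail_eq hS hν μ)]
  exact (((memLp_log_studentWeight hS hν μ).sub (memLp_const _)).const_mul _).sub
    (((memLp_studentWeight hS hν μ).sub (memLp_const _)).const_mul _)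

theorem covariance_scoreTail_left (hS : S.PosDef) (hν : 0 < ν) {Y : (Fin k → ℝ) → ℝ}
    (hY : MemLp Y 2 (law μ S ν)) :
    cov[scoreTail μ S ν, Y; law μ S ν] =
      1 / 2 * cov[fun x => Real.log (studentWeight μ S ν x), Y; law μ S ν] -
        (ν + k) / 2 / ν * cov[studentWeight μ S ν, Y; law μ S ν] := by
  have := isProbabilityMeasure_law hS hν μ
  have hlog := memLp_log_studentWeight hS hν μ
  have hw := memLp_studentWeight hS hν μ
  have hlog_sub (c : ℝ) : MemLp (fun x => Real.log (studentWeight μ S ν x) - c) 2 (law μ S ν) :=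
    hlog.sub (memLp_const c)
  have hw_sub (c : ℝ) : MemLp (fun x => studentWeight μ S ν x - c) 2 (law μ S ν) :=
    hw.sub (memLp_const c)
  rw [funext (scoreTail_eq hS hν μ),
    covariance_fun_sub_left ((hlog_sub _).const_mul _) ((hw_sub _).const_mul _) hY,
    covariance_const_mul_left, covariance_const_mul_left,
    covariance_sub_const_left (hlog.integrable one_le_two),
    covariance_sub_const_left (hw.integrable one_le_two)]

theorem covariance_scoreTail_studentWeight (hS : S.PosDef) (hν : 0 < ν) (μ : Fin k → ℝ) :
    cov[scoreTail μ S ν, studentWeight μ S ν; law μ S ν] =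
      Var[studentWeight μ S ν; law μ S ν] / ν := by
  have : 0 < ν + k := by positivity
  rw [covariance_scoreTail_left hS hν (memLp_studentWeight hS hν μ),
    covariance_self (continuous_studentWeight hS hν μ).aemeasurable,
    covariance_log_studentWeight_studentWeight hS hν, variance_studentWeight hS hν]
  field_simp
  ring

theorem covariance_scoreScatter_studentWeight (hS : S.PosDef) (hν : 0 < ν) (μ : Fin k → ℝ)
    (p : VechIdx k) :
    cov[fun x => scoreScatter μ S ν x p, studentWeight μ S ν; law μ S ν] = ν * Gamma23 μ S ν p := by
  have htail := memLp_scoreTail hS hν μ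
  have hcov := covariance_scoreTail_studentWeight hS hν μ
  rw [covariance_comm] at hcov
  have hw := covariance_scoreScatter_comp_studentWeight hS hν measurable_id'
    (memLp_studentWeight hS hν μ) p
  rw [Gamma23, funext (scoreTail_eq hS hν μ)]
  rw [funext (scoreTail_eq hS hν μ)] at htail hcov
  rw [covariance_scoreScatter_comp_studentWeight hS hν (g := fun r => 1 / 2 * (Real.log r -
    ∫ y, Real.log (radialWeight y) ∂stdLaw k ((ν + k) / 2)) - (ν + k) / 2 / ν * (r - ν / (ν + k)))
      (by fun_prop) htail, hcov, hw,
    covariance_self (continuous_studentWeight hS hν μ).aemeasurable]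
  field_simp

theorem Gamma22_mulVec_apply (hS : S.PosDef) (hν : 0 < ν) (μ : Fin k → ℝ) (s : VechIdx k → ℝ)
    (p : VechIdx k) :
    (Gamma22 μ S ν *ᵥ s) p =
      cov[fun x => scoreScatter μ S ν x p, fun x => s ⬝ᵥ scoreScatter μ S ν x; law μ S ν] := by
  have := isProbabilityMeasure_law hS hν μ
  simp only [dotProduct]
  rw [covariance_fun_sum_right (fun q => (memLp_scoreScatter hS hν μ q).const_mul (s q))
    (memLp_scoreScatter hS hν μ p)]
  simp only [covariance_const_mul_right, Matrix.mulVec, dotProduct, Gamma22, Matrix.of_apply,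
    mul_comm]

theorem covariance_dotProduct_scoreScatter_left (hS : S.PosDef) (hν : 0 < ν)
    {Y : (Fin k → ℝ) → ℝ} (hY : MemLp Y 2 (law μ S ν)) (s : VechIdx k → ℝ) :
    cov[fun x => s ⬝ᵥ scoreScatter μ S ν x, Y; law μ S ν] =
      ∑ p, s p * cov[fun x => scoreScatter μ S ν x p, Y; law μ S ν] := by
  have := isProbabilityMeasure_law hS hν μ
  simp only [dotProduct, ← covariance_const_mul_left]
  exact covariance_fun_sum_left (fun p => (memLp_scoreScatter hS hν μ p).const_mul (s p)) hY

-- `vech S ⬝ᵥ scoreScatter` and the part of `scoreTail` correlated with the scatter score are both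
-- affine in `studentWeight`.
theorem Gamma22_mulVec_vech (hS : S.PosDef) (hν : 0 < ν) (μ : Fin k → ℝ) :
    Gamma22 μ S ν *ᵥ vech S = -((ν + k) / 2 * ν) • Gamma23 μ S ν := by
  have := isProbabilityMeasure_law hS hν μ
  ext p
  rw [Gamma22_mulVec_apply hS hν, Pi.smul_apply, smul_eq_mul]
  simp only [vech_dotProduct_scoreScatter hS hν]
  rw [covariance_fun_neg_right, covariance_const_mul_right,
    covariance_sub_const_right ((memLp_studentWeight hS hν μ).integrable one_le_two),
    covariance_scoreScatter_studentWeight hS hν]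
  ring

theorem isOpenPosMeasure_law (hS : S.PosDef) (hν : 0 < ν) (μ : Fin k → ℝ) :
    (law μ S ν).IsOpenPosMeasure := by
  refine Measure.AbsolutelyContinuous.isOpenPosMeasure (μ := volume)
    (withDensity_absolutelyContinuous'
      (continuous_density hS hν μ).measurable.ennreal_ofReal.aemeasurable
      (.of_forall fun x => ?_))
  have hdet := hS.det_pos
  have hc : 0 < normConst k ν := by
    have := Real.Gamma_pos_of_pos (half_pos hν)
    have := Real.Gamma_pos_of_pos (show 0 < (ν + k) / 2 by positivity)
    unfold normConst
    positivity
  rw [density_eq_mul_exp hS hν]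
  exact (ENNReal.ofReal_pos.2 (by positivity)).ne'

theorem eq_zero_of_dotProduct_scoreScatter_eq_const (hS : S.PosDef) (hν : 0 < ν)
    {s : VechIdx k → ℝ} {c : ℝ} (h : ∀ x, s ⬝ᵥ scoreScatter μ S ν x = c) : s = 0 := by
  have hdet : IsUnit S.det := isUnit_iff_ne_zero.2 hS.det_pos.ne'
  have hunvech : unvech s = 0 := by
    refine eq_zero_of_forall_dotProduct_mulVec_eq_zero (unvech_isSymm s) fun y => ?_
    have hquad : (S *ᵥ y) ⬝ᵥ ((S⁻¹ * unvech s * S⁻¹) *ᵥ (S *ᵥ y)) = y ⬝ᵥ (unvech s *ᵥ y) := by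
      rw [Matrix.mulVec_mulVec, Matrix.dotProduct_mulVec, Matrix.vecMul_mulVec,
        ← Matrix.dotProduct_mulVec, (isSymm_of_posDef hS).eq,
        Matrix.nonsing_inv_mul_cancel_right _ _ hdet, Matrix.mul_nonsing_inv_cancel_left _ _ hdet]
    have hy := (h (μ + S *ᵥ y)).trans (h μ).symm
    have hw := studentWeight_pos hS hν μ (μ + S *ᵥ y)
    rw [dotProduct_scoreScatter hS hν, dotProduct_scoreScatter hS hν, sub_self,
      zero_dotProduct, zero_mul, mul_zero, sub_left_inj, add_sub_cancel_left, hquad] at hy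
    have : (ν + k) / 2 / ν ≠ 0 := by positivity
    exact (mul_eq_zero.1 ((mul_eq_zero.1 hy).resolve_left this)).resolve_right hw.ne'
  rw [← vech_unvech s, hunvech]
  rfl

theorem det_Gamma22_ne_zero (hS : S.PosDef) (hν : 0 < ν) (μ : Fin k → ℝ) :
    (Gamma22 μ S ν).det ≠ 0 := by
  have := isProbabilityMeasure_law hS hν μ
  have := isOpenPosMeasure_law hS hν μ
  intro hdet
  obtain ⟨s, hs_ne, hs⟩ := Matrix.exists_mulVec_eq_zero_iff.2 hdet
  refine hs_ne ?_
  have hmem : MemLp (fun x => s ⬝ᵥ scoreScatter μ S ν x) 2 (law μ S ν) :=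
    memLp_finsetSum _ fun p _ => (memLp_scoreScatter hS hν μ p).const_mul (s p)
  have hcont : Continuous fun x => s ⬝ᵥ scoreScatter μ S ν x := by
    simp only [dotProduct_scoreScatter hS hν]
    exact ((continuous_dotProduct_mulVec_mul_studentWeight hS hν _ μ).const_mul _).sub
      continuous_const
  have hvar : Var[fun x => s ⬝ᵥ scoreScatter μ S ν x; law μ S ν] = 0 := by
    rw [← covariance_self hcont.aemeasurable,
      covariance_dotProduct_scoreScatter_left hS hν hmem]
    simp only [← Gamma22_mulVec_apply hS hν, hs, Pi.zero_apply, mul_zero, Finset.sum_const_zero]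
  have hconst : (fun x => s ⬝ᵥ scoreScatter μ S ν x) =ᵐ[law μ S ν] fun _ =>
      ∫ x, s ⬝ᵥ scoreScatter μ S ν x ∂law μ S ν := by
    rw [← evariance_eq_zero_iff hcont.aemeasurable, ← hmem.ofReal_variance_eq, hvar,
      ENNReal.ofReal_zero]
  exact eq_zero_of_dotProduct_scoreScatter_eq_const hS hν
    (congrFun ((hcont.ae_eq_iff_eq (law μ S ν) continuous_const).1 hconst))

theorem isSymm_Gamma22 (μ : Fin k → ℝ) (S : Matrix (Fin k) (Fin k) ℝ) (ν : ℝ) :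
    (Gamma22 μ S ν).IsSymm :=
  Matrix.IsSymm.ext fun _ _ => covariance_comm _ _

theorem Gamma23_dotProduct_inv_Gamma22_mulVec (hS : S.PosDef) (hν : 0 < ν) (μ : Fin k → ℝ)
    (r : VechIdx k → ℝ) :
    Gamma23 μ S ν ⬝ᵥ ((Gamma22 μ S ν)⁻¹ *ᵥ r) = -((ν + k) / 2 * ν)⁻¹ * (vech S ⬝ᵥ r) := by
  have hne : -((ν + k) / 2 * ν) ≠ 0 := neg_ne_zero.2 (by positivity)
  have hinv : (Gamma22 μ S ν)⁻¹ *ᵥ Gamma23 μ S ν = (-((ν + k) / 2 * ν))⁻¹ • vech S := by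
    rw [← inv_smul_smul₀ hne (Gamma23 μ S ν), ← Gamma22_mulVec_vech hS hν, Matrix.mulVec_smul,
      Matrix.mulVec_mulVec,
      Matrix.nonsing_inv_mul _ (isUnit_iff_ne_zero.2 (det_Gamma22_ne_zero hS hν μ)),
      Matrix.one_mulVec]
  rw [← Matrix.dotProduct_transpose_mulVec, (isSymm_Gamma22 μ S ν).inv.eq, hinv, dotProduct_comm,
    smul_dotProduct, inv_neg, smul_eq_mul]

theorem Gamma33Star_eq (hS : S.PosDef) (hν : 0 < ν) (μ : Fin k → ℝ) :
    Gamma33Star μ S ν =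
      1 / 4 * Var[fun y : Fin k → ℝ => Real.log (radialWeight y); stdLaw k ((ν + k) / 2)] -
        k * (ν + k + 2) / (2 * ν * (ν + k) ^ 2) := by
  have := isProbabilityMeasure_law hS hν μ
  have hlog := memLp_log_studentWeight hS hν μ
  have hw := memLp_studentWeight hS hν μ
  have : 0 < ν + k := by positivity
  have hvech : vech S ⬝ᵥ Gamma23 μ S ν =
      -((ν + k) / 2 * (Var[studentWeight μ S ν; law μ S ν] / ν)) := by
    rw [← covariance_scoreTail_studentWeight hS hν, covariance_comm (scoreTail μ S ν)]
    refine (covariance_dotProduct_scoreScatter_left hS hν (memLp_scoreTail hS hν μ) _).symm.trans ?_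
    simp only [vech_dotProduct_scoreScatter hS hν]
    rw [covariance_fun_neg_left, covariance_const_mul_left,
      covariance_sub_const_left (hw.integrable one_le_two)]
  rw [Gamma33Star, Gamma23_dotProduct_inv_Gamma22_mulVec hS hν, hvech, Gamma33,
    covariance_scoreTail_left hS hν (memLp_scoreTail hS hν μ),
    covariance_comm _ (scoreTail μ S ν), covariance_scoreTail_left hS hν hlog,
    covariance_self hlog.aemeasurable, covariance_comm _ (fun x => Real.log _),
    covariance_comm _ (scoreTail μ S ν),
    covariance_scoreTail_studentWeight hS hν, variance_log_studentWeight hS hν,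
    covariance_log_studentWeight_studentWeight hS hν, variance_studentWeight hS hν]
  field_simp
  ring

end Information

section MahalanobisLipschitz

open Asymptotics
open scoped Matrix.Norms.Operator

theorem isBigO_dotProduct_mulVec {α ι : Type*} [Fintype ι] [DecidableEq ι] {l : Filter α}
    {D : α → Matrix ι ι ℝ} {u v : α → ι → ℝ} {d f g : α → ℝ} (hD : D =O[l] d) (hu : u =O[l] f)
    (hv : v =O[l] g) :
    (fun p => u p ⬝ᵥ (D p *ᵥ v p)) =O[l] fun p => d p * (f p * g p) :=
  (IsBigO.of_bound (Fintype.card ι) (.of_forall fun p => by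
    simpa only [norm_mul, norm_norm, Real.norm_eq_abs, abs_norm] using
      abs_dotProduct_mulVec_le (D p) (u p) (v p))).trans
    (hD.norm_left.mul (hu.norm_left.mul hv.norm_left))

variable {k : ℕ} {S : Matrix (Fin k) (Fin k) ℝ}

theorem mahalanobisSq_sub_mahalanobisSq (μ μ' : Fin k → ℝ) (S S' : Matrix (Fin k) (Fin k) ℝ)
    (x : Fin k → ℝ) :
    mahalanobisSq μ' S' x - mahalanobisSq μ S x =
      (x - μ) ⬝ᵥ ((S'⁻¹ - S⁻¹) *ᵥ (x - μ)) - (x - μ) ⬝ᵥ (S'⁻¹ *ᵥ (μ' - μ)) -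
        (μ' - μ) ⬝ᵥ (S'⁻¹ *ᵥ (x - μ - (μ' - μ))) := by
  rw [mahalanobisSq, mahalanobisSq, ← sub_sub_sub_cancel_right x μ' μ]
  simp only [Matrix.sub_mulVec, Matrix.mulVec_sub, dotProduct_sub, sub_dotProduct]
  ring

theorem isBigO_one_add_norm_sub_sq (hS : S.PosDef) (μ : Fin k → ℝ)
    (l : Filter (Fin k → ℝ)) :
    (fun x => (1 + ‖x - μ‖) * (1 + ‖x - μ‖)) =O[l] fun x => 1 + mahalanobisSq μ S x := by
  refine .of_bound (2 * (1 + S.trace)) (.of_forall fun x => ?_)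
  have hd := mahalanobisSq_nonneg hS μ x
  have htr := hS.posSemidef.trace_nonneg
  have hz := (norm_sq_le_dotProduct_self (x - μ)).trans (sub_dotProduct_sub_le hS μ x)
  rw [Real.norm_of_nonneg (by positivity), Real.norm_of_nonneg (by positivity)]
  nlinarith [sq_nonneg (‖x - μ‖ - 1)]

theorem isBigO_mahalanobisSq_sub (hS : S.PosDef) (μ : Fin k → ℝ) :
    (fun p : ((Fin k → ℝ) × Matrix (Fin k) (Fin k) ℝ) × (Fin k → ℝ) =>
      mahalanobisSq p.1.1 p.1.2 p.2 - mahalanobisSq μ S p.2) =O[𝓝 (μ, S) ×ˢ ⊤]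
        fun p => ‖p.1 - (μ, S)‖ * (1 + mahalanobisSq μ S p.2) := by
  set l : Filter (((Fin k → ℝ) × Matrix (Fin k) (Fin k) ℝ) × (Fin k → ℝ)) := 𝓝 (μ, S) ×ˢ ⊤
  have hfst : Tendsto Prod.fst l (𝓝 (μ, S)) := tendsto_fst
  let δ (p : ((Fin k → ℝ) × Matrix (Fin k) (Fin k) ℝ) × (Fin k → ℝ)) : ℝ := ‖p.1 - (μ, S)‖
  let R (p : ((Fin k → ℝ) × Matrix (Fin k) (Fin k) ℝ) × (Fin k → ℝ)) : ℝ := 1 + ‖p.2 - μ‖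
  have hinv : HasFDerivAt (fun θ : (Fin k → ℝ) × Matrix (Fin k) (Fin k) ℝ => θ.2⁻¹) _ (μ, S) :=
    (hasFDerivAt_matrix_inv hS.det_pos.ne').comp (μ, S) hasFDerivAt_snd
  have hdiff : (fun p => p.1.2⁻¹ - S⁻¹) =O[l] δ :=
    (hinv.isBigO_sub.comp_tendsto hfst).norm_right
  have hbdd : (fun p => p.1.2⁻¹) =O[l] fun _ => (1 : ℝ) :=
    (hinv.continuousAt.tendsto.isBigO_one ℝ).comp_tendsto hfst
  have hshift : (fun p => p.1.1 - μ) =O[l] δ :=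
    (isBigO_fst_prod' (l := l) (f' := fun p => p.1 - (μ, S))).norm_right
  have hshift' : (fun p => p.1.1 - μ) =O[l] fun _ => (1 : ℝ) :=
    (((continuous_fst.tendsto (μ, S)).sub_const μ).isBigO_one ℝ).comp_tendsto hfst
  have hone : (fun _ => (1 : ℝ)) =O[l] R := .of_bound 1 <| .of_forall fun p => by
    have := norm_nonneg (p.2 - μ)
    rw [norm_one, one_mul, Real.norm_of_nonneg (by positivity)]
    linarith
  have hz : (fun p => p.2 - μ) =O[l] R := .of_bound 1 <| .of_forall fun p => by
    rw [one_mul, Real.norm_of_nonneg (by positivity)]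
    linarith
  have hR : (fun p => R p * R p) =O[l] fun p => 1 + mahalanobisSq μ S p.2 :=
    (isBigO_one_add_norm_sub_sq hS μ ⊤).comp_tendsto tendsto_snd
  simp only [mahalanobisSq_sub_mahalanobisSq]
  have hquad := (isBigO_dotProduct_mulVec hdiff hz hz).trans ((isBigO_refl δ l).mul hR)
  have hδR : (fun p => δ p * R p) =O[l] fun p => δ p * (1 + mahalanobisSq μ S p.2) := by
    simpa only [one_mul] using (isBigO_refl δ l).mul ((hone.mul (isBigO_refl R l)).trans hR)
  refine (hquad.sub ((isBigO_dotProduct_mulVec hbdd hz hshift).trans ?_)).sub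
    ((isBigO_dotProduct_mulVec hbdd hshift (hz.sub (hshift'.trans hone))).trans ?_)
  · simpa only [one_mul, mul_comm (R _)] using hδR
  · simpa only [one_mul] using hδR

end MahalanobisLipschitz

section EfficientScore

variable {k : ℕ} {S : Matrix (Fin k) (Fin k) ℝ} {ν : ℝ}

/-- The part of the efficient score for tail weight that does not depend on the observation. -/
noncomputable def efficientConst (k : ℕ) (ν : ℝ) : ℝ :=
  1 / 2 * Real.log ν -
    1 / 2 * ∫ y : Fin k → ℝ, Real.log (radialWeight y) ∂stdLaw k ((ν + k) / 2) +
      (ν + k + 2) / (2 * (ν + k))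

/-- The efficient score for tail weight, i.e. the residual of `scoreTail` regressed on
`scoreScatter`. It is written in terms of `ν + mahalanobisSq μ S x`, which is affine in `ν`. -/
noncomputable def efficientScore (μ : Fin k → ℝ) (S : Matrix (Fin k) (Fin k) ℝ) (ν : ℝ)
    (x : Fin k → ℝ) : ℝ :=
  efficientConst k ν - 1 / 2 * Real.log (ν + mahalanobisSq μ S x) -
    (ν + k + 2) / 2 * (ν + mahalanobisSq μ S x)⁻¹

theorem studentWeight_eq (hν : ν ≠ 0) (μ : Fin k → ℝ) (S : Matrix (Fin k) (Fin k) ℝ)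
    (x : Fin k → ℝ) : studentWeight μ S ν x = ν * (ν + mahalanobisSq μ S x)⁻¹ := by
  rw [studentWeight, one_add_div hν, inv_div, div_eq_mul_inv]

theorem add_mahalanobisSq_pos (hS : S.PosDef) (hν : 0 < ν) (μ x : Fin k → ℝ) :
    0 < ν + mahalanobisSq μ S x :=
  add_pos_of_pos_of_nonneg hν (mahalanobisSq_nonneg hS μ x)

theorem efficientScore_eq_studentWeight (hS : S.PosDef) (hν : 0 < ν) (μ x : Fin k → ℝ) :
    efficientScore μ S ν x =
      1 / 2 * (Real.log (studentWeight μ S ν x) -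
        ∫ y : Fin k → ℝ, Real.log (radialWeight y) ∂stdLaw k ((ν + k) / 2)) -
          (ν + k + 2) / (2 * ν) * (studentWeight μ S ν x - ν / (ν + k)) := by
  have hA := add_mahalanobisSq_pos hS hν μ x
  have : 0 < ν + k := by positivity
  rw [studentWeight_eq hν.ne', Real.log_mul hν.ne' (inv_ne_zero hA.ne'), Real.log_inv,
    efficientScore, efficientConst]
  field_simp
  ring

theorem scoreTail_add_dotProduct_scoreScatter (hS : S.PosDef) (hν : 0 < ν) (μ x : Fin k → ℝ) :
    scoreTail μ S ν x + ((ν + k) / 2 * ν)⁻¹ * (vech S ⬝ᵥ scoreScatter μ S ν x) =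
      efficientScore μ S ν x := by
  have : 0 < ν + k := by positivity
  rw [scoreTail_eq hS hν, vech_dotProduct_scoreScatter hS hν,
    efficientScore_eq_studentWeight hS hν]
  field_simp
  ring

theorem Delta3Star_eq (hS : S.PosDef) (hν : 0 < ν) (μ : Fin k → ℝ) (n : ℕ)
    (X : Fin n → Fin k → ℝ) :
    Delta3Star n μ S ν X = (√(n : ℝ))⁻¹ * ∑ i, efficientScore μ S ν (X i) := by
  simp only [← scoreTail_add_dotProduct_scoreScatter hS hν, Finset.sum_add_distrib,
    ← Finset.mul_sum, ← dotProduct_sum]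
  rw [Delta3Star, Gamma23_dotProduct_inv_Gamma22_mulVec hS hν, Delta2, Delta3, dotProduct_smul,
    smul_eq_mul]
  ring

theorem measurable_efficientScore (μ : Fin k → ℝ) (S : Matrix (Fin k) (Fin k) ℝ) (ν : ℝ) :
    Measurable (efficientScore μ S ν) := by
  have hA : Measurable fun x => ν + mahalanobisSq μ S x :=
    (continuous_mahalanobisSq μ S).measurable.const_add ν
  exact ((hA.log.const_mul _).const_sub _).sub (hA.inv.const_mul _)

theorem integrable_efficientScore (hS : S.PosDef) (hν : 0 < ν) (μ : Fin k → ℝ) :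
    Integrable (efficientScore μ S ν) (law μ S ν) := by
  have := isProbabilityMeasure_law hS hν μ
  simp only [funext (efficientScore_eq_studentWeight hS hν μ)]
  exact ((((memLp_log_studentWeight hS hν μ).integrable one_le_two).sub
    (integrable_const _)).const_mul _).sub
    ((((memLp_studentWeight hS hν μ).integrable one_le_two).sub (integrable_const _)).const_mul _)

theorem hasDerivAt_efficientConst (k : ℕ) (hν : 0 < ν) :
    HasDerivAt (efficientConst k)
      (1 / (2 * ν) -
        1 / 4 * Var[fun y : Fin k → ℝ => Real.log (radialWeight y); stdLaw k ((ν + k) / 2)] -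
          1 / (ν + k) ^ 2) ν := by
  have : 0 < ν + k := by positivity
  have hadd : HasDerivAt (fun t : ℝ => t + k) 1 ν := (hasDerivAt_id ν).add_const _
  have hL := (hasDerivAt_integral_log_radialWeight (half_lt_half_add k hν)).comp ν
    (hadd.div_const 2)
  have hquot := (hadd.add_const 2).div (hadd.const_mul 2) (by positivity)
  refine ((((Real.hasDerivAt_log hν.ne').const_mul (1 / 2)).sub (hL.const_mul (1 / 2))).add
    hquot).congr_deriv ?_
  field_simp
  ring

end EfficientScore

section EfficientScoreDerivative

open scoped Matrix.Norms.Operator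

variable {k : ℕ} {S : Matrix (Fin k) (Fin k) ℝ} {ν : ℝ}

/-- The derivative of `efficientScore` with respect to the squared Mahalanobis distance `t`. -/
noncomputable def efficientScoreSlope (k : ℕ) (ν t : ℝ) : ℝ :=
  (ν + k + 2) / 2 * (ν + t)⁻¹ ^ 2 - 1 / 2 * (ν + t)⁻¹

/-- The derivative of `efficientScore` with respect to the parameter `((μ, S), ν)`. -/
noncomputable def efficientScoreDeriv (μ : Fin k → ℝ) (S : Matrix (Fin k) (Fin k) ℝ) (ν : ℝ)
    (x : Fin k → ℝ) : ((Fin k → ℝ) × Matrix (Fin k) (Fin k) ℝ) × ℝ →L[ℝ] ℝ :=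
  (deriv (efficientConst k) ν - 1 / 2 * (ν + mahalanobisSq μ S x)⁻¹) •
      ContinuousLinearMap.snd ℝ _ ℝ +
    efficientScoreSlope k ν (mahalanobisSq μ S x) •
      (ContinuousLinearMap.snd ℝ _ ℝ +
        (mahalanobisSqDeriv μ S x).comp (ContinuousLinearMap.fst ℝ _ ℝ))

theorem efficientScoreDeriv_apply (μ : Fin k → ℝ) (S : Matrix (Fin k) (Fin k) ℝ) (ν : ℝ)
    (x : Fin k → ℝ) (v : ((Fin k → ℝ) × Matrix (Fin k) (Fin k) ℝ) × ℝ) :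
    efficientScoreDeriv μ S ν x v =
      (deriv (efficientConst k) ν - 1 / 2 * (ν + mahalanobisSq μ S x)⁻¹) * v.2 +
        efficientScoreSlope k ν (mahalanobisSq μ S x) * (v.2 + mahalanobisSqDeriv μ S x v.1) :=
  rfl

theorem hasFDerivAt_efficientScore (hS : S.PosDef) (hν : 0 < ν) (μ x : Fin k → ℝ) :
    HasFDerivAt (fun θ : ((Fin k → ℝ) × Matrix (Fin k) (Fin k) ℝ) × ℝ =>
      efficientScore θ.1.1 θ.1.2 θ.2 x) (efficientScoreDeriv μ S ν x) ((μ, S), ν) := by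
  have hA := (add_mahalanobisSq_pos hS hν μ x).ne'
  have hsnd : HasFDerivAt (fun θ : ((Fin k → ℝ) × Matrix (Fin k) (Fin k) ℝ) × ℝ => θ.2)
      (ContinuousLinearMap.snd ℝ _ ℝ) ((μ, S), ν) := hasFDerivAt_snd
  have hd : HasFDerivAt (fun θ : ((Fin k → ℝ) × Matrix (Fin k) (Fin k) ℝ) × ℝ =>
      mahalanobisSq θ.1.1 θ.1.2 x) _ ((μ, S), ν) :=
    HasFDerivAt.comp (g := fun θ : (Fin k → ℝ) × Matrix (Fin k) (Fin k) ℝ =>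
        mahalanobisSq θ.1 θ.2 x) ((μ, S), ν)
      (hasFDerivAt_mahalanobisSq hS.det_pos.ne' (isSymm_of_posDef hS) μ x) hasFDerivAt_fst
  have hadd := hsnd.add hd
  have hc := (hasDerivAt_efficientConst k hν).differentiableAt.hasDerivAt.comp_hasFDerivAt
    ((μ, S), ν) hsnd
  have hb : HasFDerivAt (fun θ : ((Fin k → ℝ) × Matrix (Fin k) (Fin k) ℝ) × ℝ =>
      (θ.2 + k + 2) / 2) _ ((μ, S), ν) :=
    ((hsnd.add_const (k : ℝ)).add_const 2).mul_const (2 : ℝ)⁻¹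
  refine ((hc.sub ((hadd.log hA).const_mul (1 / 2))).sub
    (hb.mul ((hasDerivAt_inv hA).comp_hasFDerivAt ((μ, S), ν) hadd))).congr_fderiv ?_
  refine ContinuousLinearMap.ext fun v => ?_
  have happly : deriv (efficientConst k) ν * v.2 -
      1 / 2 * ((ν + mahalanobisSq μ S x)⁻¹ * (v.2 + mahalanobisSqDeriv μ S x v.1)) -
        ((ν + k + 2) / 2 * (-((ν + mahalanobisSq μ S x) ^ 2)⁻¹ *
          (v.2 + mahalanobisSqDeriv μ S x v.1)) + (ν + mahalanobisSq μ S x)⁻¹ * (2⁻¹ * v.2)) =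
            efficientScoreDeriv μ S ν x v := by
    rw [efficientScoreDeriv_apply, efficientScoreSlope, inv_pow]
    ring
  exact happly

end EfficientScoreDerivative

section EfficientScoreLipschitz

open Asymptotics
open scoped Matrix.Norms.Operator

variable {k : ℕ} {S : Matrix (Fin k) (Fin k) ℝ} {ν : ℝ}

theorem isBigO_inv_add_mahalanobisSq (hS : S.PosDef) (hν : 0 < ν) (μ : Fin k → ℝ)
    (l : Filter (Fin k → ℝ)) :
    (fun x => (ν + mahalanobisSq μ S x)⁻¹) =O[l] fun _ => (1 : ℝ) := by
  refine .of_bound ν⁻¹ (.of_forall fun x => ?_)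
  have hd := mahalanobisSq_nonneg hS μ x
  rw [norm_one, mul_one, Real.norm_of_nonneg (by positivity)]
  gcongr
  linarith

theorem isBigO_add_mahalanobisSq_div_sub_one (hS : S.PosDef) (hν : 0 < ν) (μ : Fin k → ℝ) :
    (fun p : (((Fin k → ℝ) × Matrix (Fin k) (Fin k) ℝ) × ℝ) × (Fin k → ℝ) =>
      (p.1.2 + mahalanobisSq p.1.1.1 p.1.1.2 p.2) / (ν + mahalanobisSq μ S p.2) - 1)
        =O[𝓝 ((μ, S), ν) ×ˢ ⊤] fun p => p.1 - ((μ, S), ν) := by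
  set l : Filter ((((Fin k → ℝ) × Matrix (Fin k) (Fin k) ℝ) × ℝ) × (Fin k → ℝ)) :=
    𝓝 ((μ, S), ν) ×ˢ ⊤
  let δ (p : (((Fin k → ℝ) × Matrix (Fin k) (Fin k) ℝ) × ℝ) × (Fin k → ℝ)) : ℝ :=
    ‖p.1 - ((μ, S), ν)‖
  have hinv : (fun p => (ν + mahalanobisSq μ S p.2)⁻¹) =O[l] fun _ => (1 : ℝ) :=
    (isBigO_inv_add_mahalanobisSq hS hν μ ⊤).comp_tendsto tendsto_snd
  have htail : (fun p => p.1.2 - ν) =O[l] δ :=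
    (isBigO_snd_prod' (l := l) (f' := fun p => p.1 - ((μ, S), ν))).norm_right
  have hfst : (fun p => ‖p.1.1 - (μ, S)‖) =O[l] δ :=
    (isBigO_fst_prod' (l := l) (f' := fun p => p.1 - ((μ, S), ν))).norm_norm
  have hmah : (fun p => mahalanobisSq p.1.1.1 p.1.1.2 p.2 - mahalanobisSq μ S p.2) =O[l]
      fun p => δ p * (1 + mahalanobisSq μ S p.2) :=
    ((isBigO_mahalanobisSq_sub hS μ).comp_tendsto
      ((continuous_fst.tendsto ((μ, S), ν)).prodMap tendsto_id)).trans
      (hfst.mul (isBigO_refl _ l))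
  have hratio : (fun p => (1 + mahalanobisSq μ S p.2) * (ν + mahalanobisSq μ S p.2)⁻¹) =O[l]
      fun _ => (1 : ℝ) := by
    refine ((isBigO_const_const (1 : ℝ) one_ne_zero l).add (hinv.const_mul_left (1 - ν))).congr_left
      fun p => ?_
    have := (add_mahalanobisSq_pos hS hν μ p.2).ne'
    field_simp
    ring
  have hsum : (fun p => (p.1.2 - ν) * (ν + mahalanobisSq μ S p.2)⁻¹ +
      (mahalanobisSq p.1.1.1 p.1.1.2 p.2 - mahalanobisSq μ S p.2) *
        (ν + mahalanobisSq μ S p.2)⁻¹) =O[l] δ := by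
    refine ((htail.mul hinv).congr_right fun p => mul_one _).add ((hmah.mul
      (isBigO_refl (fun p => (ν + mahalanobisSq μ S p.2)⁻¹) l)).trans ?_)
    simpa only [mul_assoc, mul_one] using (isBigO_refl δ l).mul hratio
  refine (hsum.congr_left fun p => ?_).of_norm_right
  have := (add_mahalanobisSq_pos hS hν μ p.2).ne'
  field_simp
  ring

theorem efficientScore_sub_efficientScore {μ μ' x : Fin k → ℝ} {S S' : Matrix (Fin k) (Fin k) ℝ}
    {ν ν' : ℝ} (hA : ν + mahalanobisSq μ S x ≠ 0) (hA' : ν' + mahalanobisSq μ' S' x ≠ 0) :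
    efficientScore μ' S' ν' x - efficientScore μ S ν x =
      efficientConst k ν' - 1 / 2 * Real.log ((ν' + mahalanobisSq μ' S' x) /
        (ν + mahalanobisSq μ S x)) - efficientConst k ν -
      ((ν' + k + 2) / 2 * ((ν' + mahalanobisSq μ' S' x) / (ν + mahalanobisSq μ S x))⁻¹ -
        (ν + k + 2) / 2) * (ν + mahalanobisSq μ S x)⁻¹ := by
  rw [efficientScore, efficientScore, Real.log_div hA' hA]
  field_simp
  ring

theorem isBigO_efficientScore_sub (hS : S.PosDef) (hν : 0 < ν) (μ : Fin k → ℝ) :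
    (fun p : (((Fin k → ℝ) × Matrix (Fin k) (Fin k) ℝ) × ℝ) × (Fin k → ℝ) =>
      efficientScore p.1.1.1 p.1.1.2 p.1.2 p.2 - efficientScore μ S ν p.2)
        =O[𝓝 ((μ, S), ν) ×ˢ ⊤] fun p => p.1 - ((μ, S), ν) := by
  set l : Filter ((((Fin k → ℝ) × Matrix (Fin k) (Fin k) ℝ) × ℝ) × (Fin k → ℝ)) :=
    𝓝 ((μ, S), ν) ×ˢ ⊤
  let q (p : (((Fin k → ℝ) × Matrix (Fin k) (Fin k) ℝ) × ℝ) × (Fin k → ℝ)) : ℝ × ℝ :=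
    (p.1.2, (p.1.2 + mahalanobisSq p.1.1.1 p.1.1.2 p.2) / (ν + mahalanobisSq μ S p.2))
  have hq : (fun p => q p - (ν, 1)) =O[l] fun p => p.1 - ((μ, S), ν) :=
    (isBigO_snd_prod' (l := l) (f' := fun p => p.1 - ((μ, S), ν))).prod_left
      (isBigO_add_mahalanobisSq_div_sub_one hS hν μ)
  have hq_tendsto : Tendsto q l (𝓝 (ν, 1)) := by
    have h0 : Tendsto (fun p => p.1 - ((μ, S), ν)) l (𝓝 0) := by
      simpa using (tendsto_fst (f := 𝓝 ((μ, S), ν)) (g := (⊤ : Filter (Fin k → ℝ)))).sub_const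
        ((μ, S), ν)
    simpa using (hq.trans_tendsto h0).add_const (ν, (1 : ℝ))
  let F₁ (t : ℝ × ℝ) : ℝ := efficientConst k t.1 - 1 / 2 * Real.log t.2
  let F₂ (t : ℝ × ℝ) : ℝ := (t.1 + k + 2) / 2 * t.2⁻¹
  have hF₁ : DifferentiableAt ℝ F₁ (ν, 1) := by
    have := (hasDerivAt_efficientConst k hν).differentiableAt
    fun_prop (disch := simp)
  have hF₂ : DifferentiableAt ℝ F₂ (ν, 1) := by fun_prop (disch := simp)
  have hbdd : (fun p => (ν + mahalanobisSq μ S p.2)⁻¹) =O[l] fun _ => (1 : ℝ) :=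
    (isBigO_inv_add_mahalanobisSq hS hν μ ⊤).comp_tendsto tendsto_snd
  have h₁ := (hF₁.isBigO_sub.comp_tendsto hq_tendsto).trans hq
  have h₂ := ((hF₂.isBigO_sub.comp_tendsto hq_tendsto).trans hq).norm_right.mul hbdd
  refine (h₁.sub (h₂.congr_right fun p => mul_one _).of_norm_right).congr' ?_ .rfl
  filter_upwards [((continuous_snd.tendsto _).comp hq_tendsto).eventually_ne one_ne_zero] with p hp
  have hA := (add_mahalanobisSq_pos hS hν μ p.2).ne'
  rw [efficientScore_sub_efficientScore hA (div_ne_zero_iff.1 hp).1]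
  simp only [F₁, F₂, q, Function.comp, Real.log_one, inv_one, mul_zero, mul_one, sub_zero]

theorem exists_eventually_abs_efficientScore_sub_le (hS : S.PosDef) (hν : 0 < ν)
    (μ : Fin k → ℝ) :
    ∃ K : ℝ, ∀ᶠ θ : ((Fin k → ℝ) × Matrix (Fin k) (Fin k) ℝ) × ℝ in 𝓝 ((μ, S), ν), ∀ x,
      |efficientScore θ.1.1 θ.1.2 θ.2 x - efficientScore μ S ν x| ≤ K * ‖θ - ((μ, S), ν)‖ := by
  obtain ⟨K, hK⟩ := (isBigO_efficientScore_sub hS hν μ).bound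
  exact ⟨K, mem_prod_top.1 hK⟩

end EfficientScoreLipschitz

section EfficientScoreDerivativeMean

open scoped Matrix.Norms.Operator

variable {k : ℕ} {S : Matrix (Fin k) (Fin k) ℝ} {ν : ℝ}

theorem integrable_efficientScoreDeriv (hS : S.PosDef) (hν : 0 < ν) (μ : Fin k → ℝ)
    (v : ((Fin k → ℝ) × Matrix (Fin k) (Fin k) ℝ) × ℝ) :
    Integrable (fun x => efficientScoreDeriv μ S ν x v) (law μ S ν) := by
  have := isProbabilityMeasure_law hS hν μ
  obtain ⟨K, hlip⟩ := exists_eventually_abs_efficientScore_sub_le hS hν μ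
  have hderiv := hasFDerivAt_efficientScore hS hν μ
  have hmeas (θ : ((Fin k → ℝ) × Matrix (Fin k) (Fin k) ℝ) × ℝ) :
      AEStronglyMeasurable (efficientScore θ.1.1 θ.1.2 θ.2) (law μ S ν) :=
    (measurable_efficientScore θ.1.1 θ.1.2 θ.2).aestronglyMeasurable
  exact (hasFDerivAt_integral_of_dominated_loc_of_lip' hlip (fun θ _ => hmeas θ)
    (integrable_efficientScore hS hν μ) (aestronglyMeasurable_of_hasFDerivAt hmeas hderiv)
    (ae_of_all _ fun x θ hθ => hθ x) (integrable_const K)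
    (ae_of_all _ hderiv)).1.apply_continuousLinearMap v

theorem integral_mahalanobisSqDeriv_mul (hS : S.PosDef) (hν : 0 < ν) {μ : Fin k → ℝ} {φ : ℝ → ℝ}
    (hφ : Measurable φ)
    (hint : ∀ v, Integrable (fun x => mahalanobisSqDeriv μ S x v * φ (mahalanobisSq μ S x))
      (law μ S ν)) (v : (Fin k → ℝ) × Matrix (Fin k) (Fin k) ℝ) :
    ∫ x, mahalanobisSqDeriv μ S x v * φ (mahalanobisSq μ S x) ∂law μ S ν =
      -((S⁻¹ * v.2).trace / k *
        ∫ x, mahalanobisSq μ S x * φ (mahalanobisSq μ S x) ∂law μ S ν) := by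
  have hunit : IsUnit S.det := hS.det_pos.ne'.isUnit
  have hscatter (x : Fin k → ℝ) (D : Matrix (Fin k) (Fin k) ℝ) :
      mahalanobisSqDeriv μ S x (0, D) = -((x - μ) ⬝ᵥ ((S⁻¹ * D * S⁻¹) *ᵥ (x - μ))) :=
    (mahalanobisSqDeriv_apply μ S x (0, D)).trans (by rw [zero_dotProduct, mul_zero, sub_zero])
  have hlocation (x : Fin k → ℝ) (m : Fin k → ℝ) :
      mahalanobisSqDeriv μ S x (m, 0) = -(2 * (m ⬝ᵥ (S⁻¹ *ᵥ (x - μ)))) :=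
    (mahalanobisSqDeriv_apply μ S x (m, 0)).trans (by
      rw [Matrix.mul_zero, Matrix.zero_mul, Matrix.zero_mulVec, dotProduct_zero,
        neg_zero, zero_sub])
  have hodd :
      ∫ x, mahalanobisSqDeriv μ S x (v.1, 0) * φ (mahalanobisSq μ S x) ∂law μ S ν = 0 :=
    integral_law_eq_zero_of_odd hS hν fun z => by
      simp only [hlocation, mahalanobisSq, sub_sub_cancel_left, add_sub_cancel_left,
        Matrix.mulVec_neg, dotProduct_neg, neg_dotProduct, neg_neg, mul_neg, neg_mul]
  have hd : Integrable (fun x => mahalanobisSq μ S x * φ (mahalanobisSq μ S x)) (law μ S ν) := by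
    refine (hint (0, S)).neg.congr (ae_of_all _ fun x => ?_)
    simp only [Pi.neg_apply, hscatter, Matrix.nonsing_inv_mul S hunit, one_mul, neg_mul, neg_neg,
      mahalanobisSq]
  have hadd (x : Fin k → ℝ) : mahalanobisSqDeriv μ S x v =
      mahalanobisSqDeriv μ S x (v.1, 0) + mahalanobisSqDeriv μ S x (0, v.2) := by
    rw [← map_add, Prod.fst_add_snd]
  simp only [hadd, add_mul]
  rw [integral_add (hint _) (hint _), hodd, zero_add]
  simp only [hscatter, neg_mul]
  rw [integral_neg, integral_law_dotProduct_mulVec hS hν hφ hd,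
    Matrix.nonsing_inv_mul_cancel_right _ _ hunit]

theorem integral_studentWeight (hS : S.PosDef) (hν : 0 < ν) (μ : Fin k → ℝ) :
    ∫ x, studentWeight μ S ν x ∂law μ S ν = ν / (ν + k) := by
  have : 0 < ν + k := by positivity
  rw [(identDistrib_studentWeight hS hν μ).integral_eq,
    integral_radialWeight (half_lt_half_add k hν)]
  field_simp
  ring

theorem integral_studentWeight_sq (hS : S.PosDef) (hν : 0 < ν) (μ : Fin k → ℝ) :
    ∫ x, studentWeight μ S ν x ^ 2 ∂law μ S ν = ν * (ν + 2) / ((ν + k) * (ν + k + 2)) := by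
  have := isProbabilityMeasure_law hS hν μ
  have : 0 < ν + k := by positivity
  have hvar := variance_eq_sub (memLp_studentWeight hS hν μ)
  rw [variance_studentWeight hS hν, integral_studentWeight hS hν] at hvar
  simp only [Pi.pow_apply] at hvar
  rw [sub_eq_iff_eq_add.1 hvar.symm]
  field_simp
  ring

theorem efficientScoreSlope_mahalanobisSq (hν : ν ≠ 0) (μ : Fin k → ℝ)
    (S : Matrix (Fin k) (Fin k) ℝ) (x : Fin k → ℝ) :
    efficientScoreSlope k ν (mahalanobisSq μ S x) =
      (ν + k + 2) / (2 * ν ^ 2) * studentWeight μ S ν x ^ 2 -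
        1 / (2 * ν) * studentWeight μ S ν x := by
  rw [studentWeight_eq hν, efficientScoreSlope]
  field_simp

theorem integrable_efficientScoreSlope (hS : S.PosDef) (hν : 0 < ν) (μ : Fin k → ℝ) :
    Integrable (fun x => efficientScoreSlope k ν (mahalanobisSq μ S x)) (law μ S ν) := by
  have := isProbabilityMeasure_law hS hν μ
  have hw := memLp_studentWeight hS hν μ
  simp only [efficientScoreSlope_mahalanobisSq hν.ne']
  exact (hw.integrable_sq.const_mul _).sub ((hw.integrable one_le_two).const_mul _)

theorem integral_efficientScoreSlope (hS : S.PosDef) (hν : 0 < ν) (μ : Fin k → ℝ) :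
    ∫ x, efficientScoreSlope k ν (mahalanobisSq μ S x) ∂law μ S ν = 1 / (ν * (ν + k)) := by
  have := isProbabilityMeasure_law hS hν μ
  have : 0 < ν + k := by positivity
  have hw := memLp_studentWeight hS hν μ
  simp only [efficientScoreSlope_mahalanobisSq hν.ne']
  rw [integral_sub (hw.integrable_sq.const_mul _) ((hw.integrable one_le_two).const_mul _),
    integral_const_mul, integral_const_mul, integral_studentWeight hS hν,
    integral_studentWeight_sq hS hν]
  field_simp
  ring

theorem integral_mahalanobisSq_mul_efficientScoreSlope (hS : S.PosDef) (hν : 0 < ν)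
    (μ : Fin k → ℝ) :
    ∫ x, mahalanobisSq μ S x * efficientScoreSlope k ν (mahalanobisSq μ S x) ∂law μ S ν = 0 := by
  have := isProbabilityMeasure_law hS hν μ
  have : 0 < ν + k := by positivity
  have hw := (memLp_studentWeight hS hν μ).integrable one_le_two
  have hslope (x : Fin k → ℝ) :
      mahalanobisSq μ S x * efficientScoreSlope k ν (mahalanobisSq μ S x) =
        (ν + k + 2) / (2 * ν) * studentWeight μ S ν x - 1 / 2 -
          ν * efficientScoreSlope k ν (mahalanobisSq μ S x) := by
    have := (add_mahalanobisSq_pos hS hν μ x).ne'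
    rw [studentWeight_eq hν.ne', efficientScoreSlope]
    field_simp
    ring
  simp only [hslope]
  have hweight : Integrable (fun x => (ν + k + 2) / (2 * ν) * studentWeight μ S ν x - 1 / 2)
      (law μ S ν) := (hw.const_mul _).sub (integrable_const _)
  rw [integral_sub hweight ((integrable_efficientScoreSlope hS hν μ).const_mul _),
    integral_sub (hw.const_mul _) (integrable_const _), integral_const_mul, integral_const_mul,
    integral_studentWeight hS hν, integral_efficientScoreSlope hS hν, integral_const,
    probReal_univ, one_smul]
  field_simp
  ring

theorem integral_efficientScoreDeriv (hS : S.PosDef) (hν : 0 < ν) (μ : Fin k → ℝ)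
    (v : ((Fin k → ℝ) × Matrix (Fin k) (Fin k) ℝ) × ℝ) :
    ∫ x, efficientScoreDeriv μ S ν x v ∂law μ S ν = -(Gamma33Star μ S ν * v.2) := by
  have := isProbabilityMeasure_law hS hν μ
  have : 0 < ν + k := by positivity
  have hw := (memLp_studentWeight hS hν μ).integrable one_le_two
  have hslope := integrable_efficientScoreSlope hS hν μ
  have hmeas : Measurable (efficientScoreSlope k ν) := by
    unfold efficientScoreSlope
    fun_prop
  have hnuisance (u : (Fin k → ℝ) × Matrix (Fin k) (Fin k) ℝ) : Integrable (fun x =>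
      mahalanobisSqDeriv μ S x u * efficientScoreSlope k ν (mahalanobisSq μ S x)) (law μ S ν) := by
    refine (integrable_efficientScoreDeriv hS hν μ (u, 0)).congr (ae_of_all _ fun x => ?_)
    simp only [efficientScoreDeriv_apply, mul_zero, zero_add, mul_comm (efficientScoreSlope _ _ _)]
  have happly (x : Fin k → ℝ) : efficientScoreDeriv μ S ν x v =
      (deriv (efficientConst k) ν - 1 / (2 * ν) * studentWeight μ S ν x +
        efficientScoreSlope k ν (mahalanobisSq μ S x)) * v.2 +
          mahalanobisSqDeriv μ S x v.1 * efficientScoreSlope k ν (mahalanobisSq μ S x) := by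
    rw [efficientScoreDeriv_apply, studentWeight_eq hν.ne']
    field_simp
    ring
  have hconst : Integrable (fun x => deriv (efficientConst k) ν -
      1 / (2 * ν) * studentWeight μ S ν x) (law μ S ν) := (integrable_const _).sub (hw.const_mul _)
  have htail : Integrable (fun x => (deriv (efficientConst k) ν -
      1 / (2 * ν) * studentWeight μ S ν x + efficientScoreSlope k ν (mahalanobisSq μ S x)) * v.2)
      (law μ S ν) := (hconst.add hslope).mul_const _
  simp only [happly]
  rw [integral_add htail (hnuisance v.1), integral_mahalanobisSqDeriv_mul hS hν hmeas hnuisance,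
    integral_mahalanobisSq_mul_efficientScoreSlope hS hν, integral_mul_const,
    integral_add hconst hslope, integral_sub (integrable_const _) (hw.const_mul _), integral_const,
    integral_const_mul, integral_studentWeight hS hν, integral_efficientScoreSlope hS hν,
    (hasDerivAt_efficientConst k hν).deriv, Gamma33Star_eq hS hν, probReal_univ, one_smul]
  field_simp
  ring

end EfficientScoreDerivativeMean

section LocalAlternatives

open scoped Matrix.Norms.Operator

variable {k : ℕ} {S : Matrix (Fin k) (Fin k) ℝ} {ν : ℝ}

theorem linfty_opNorm_le_of_forall_abs_le {D : Matrix (Fin k) (Fin k) ℝ} {C : ℝ} (hC : 0 ≤ C)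
    (hD : ∀ i j, |D i j| ≤ C) : ‖D‖ ≤ k * C := by
  lift C to NNReal using hC
  have hrow (i : Fin k) : ∑ j, ‖D i j‖₊ ≤ k * C := by
    simpa using Finset.sum_le_card_nsmul Finset.univ (fun j => ‖D i j‖₊) C fun j _ => hD i j
  rw [Matrix.linfty_opNorm_def]
  exact_mod_cast Finset.sup_le fun i _ => hrow i

theorem norm_le_of_forall_abs_le {m : Fin k → ℝ} {D : Matrix (Fin k) (Fin k) ℝ} {t C : ℝ}
    (hm : ∀ i, |m i| ≤ C) (hD : ∀ i j, |D i j| ≤ C) (ht : |t| ≤ C) :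
    ‖((m, D), t)‖ ≤ (k + 1) * C := by
  have hC : 0 ≤ C := (abs_nonneg t).trans ht
  have hkC : C ≤ (k + 1) * C := le_mul_of_one_le_left hC (by simp)
  refine norm_prod_le_iff.2 ⟨norm_prod_le_iff.2
    ⟨((pi_norm_le_iff_of_nonneg hC).2 hm).trans hkC, ?_⟩, ht.trans hkC⟩
  refine (linfty_opNorm_le_of_forall_abs_le hC hD).trans ?_
  gcongr
  linarith

theorem isLittleOP_inv_sqrt_mul_sum_efficientScore (hS : S.PosDef) (hν : 0 < ν) (μ : Fin k → ℝ)
    {h : ℕ → ((Fin k → ℝ) × Matrix (Fin k) (Fin k) ℝ) × ℝ} {C : ℝ} (hh : ∀ n, ‖h n‖ ≤ C) :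
    IsLittleOP (fun n => sampleLaw n μ S ν) fun n X =>
      (√(n : ℝ))⁻¹ * ∑ i, efficientScore (μ + (√(n : ℝ))⁻¹ • (h n).1.1)
        (S + (√(n : ℝ))⁻¹ • (h n).1.2) (ν + (√(n : ℝ))⁻¹ * (h n).2) (X i) -
          ((√(n : ℝ))⁻¹ * ∑ i, efficientScore μ S ν (X i) - Gamma33Star μ S ν * (h n).2) := by
  have := isProbabilityMeasure_law hS hν μ
  obtain ⟨K, hlip⟩ := exists_eventually_abs_efficientScore_sub_le hS hν μ
  have hmeas (θ : ((Fin k → ℝ) × Matrix (Fin k) (Fin k) ℝ) × ℝ) :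
      AEStronglyMeasurable (efficientScore θ.1.1 θ.1.2 θ.2) (law μ S ν) :=
    (measurable_efficientScore θ.1.1 θ.1.2 θ.2).aestronglyMeasurable
  have hmain := isLittleOP_inv_sqrt_mul_sum_sub (θ₀ := ((μ, S), ν))
    (ψ := fun θ : ((Fin k → ℝ) × Matrix (Fin k) (Fin k) ℝ) × ℝ =>
      efficientScore θ.1.1 θ.1.2 θ.2)
    hmeas (integrable_efficientScore hS hν μ) hlip (hasFDerivAt_efficientScore hS hν μ) hh
  refine hmain.congr' (.of_forall fun n => funext fun X => ?_)
  exact congrArg _ (congrArg _ (integral_efficientScoreDeriv hS hν μ (h n))) |>.trans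
    (congrArg _ (sub_eq_add_neg _ _).symm)

end LocalAlternatives

end StudentT

theorem lemma1 {k : ℕ} (μ : Fin k → ℝ) (S : Matrix (Fin k) (Fin k) ℝ) (ν : ℝ)
    (hS : S.PosDef) (hν : 0 < ν)
    (τ₁ : ℕ → Fin k → ℝ) (τ₂ : ℕ → Matrix (Fin k) (Fin k) ℝ) (τ₃ : ℕ → ℝ)
    (hτ : ∃ C : ℝ, ∀ n, (∀ i, |τ₁ n i| ≤ C) ∧ (∀ i j, |τ₂ n i j| ≤ C) ∧ |τ₃ n| ≤ C)
    (hSτ : ∀ n : ℕ, 1 ≤ n → (S + (√(n : ℝ))⁻¹ • τ₂ n).PosDef)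
    (hντ : ∀ n : ℕ, 1 ≤ n → 0 < ν + (√(n : ℝ))⁻¹ * τ₃ n) :
    StudentT.IsLittleOP (fun n => StudentT.sampleLaw n μ S ν)
      (fun n X =>
        StudentT.Delta3Star n (μ + (√(n : ℝ))⁻¹ • τ₁ n) (S + (√(n : ℝ))⁻¹ • τ₂ n)
            (ν + (√(n : ℝ))⁻¹ * τ₃ n) X
          - (StudentT.Delta3Star n μ S ν X - StudentT.Gamma33Star μ S ν * τ₃ n))
    ∧ ((∀ n : ℕ, 1 ≤ n → τ₃ n = 0) →
      StudentT.IsLittleOP (fun n => StudentT.sampleLaw n μ S ν)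
        (fun n X =>
          StudentT.Delta3Star n (μ + (√(n : ℝ))⁻¹ • τ₁ n) (S + (√(n : ℝ))⁻¹ • τ₂ n) ν X
            - StudentT.Delta3Star n μ S ν X)) := by
  obtain ⟨C, hC⟩ := hτ
  have hscore := StudentT.isLittleOP_inv_sqrt_mul_sum_efficientScore hS hν μ
    (h := fun n => ((τ₁ n, τ₂ n), τ₃ n)) fun n =>
      StudentT.norm_le_of_forall_abs_le (hC n).1 (hC n).2.1 (hC n).2.2
  have hexpansion := hscore.congr' <| (eventually_ge_atTop 1).mono fun n hn => funext fun X => by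
    rw [← StudentT.Delta3Star_eq (hSτ n hn) (hντ n hn), ← StudentT.Delta3Star_eq hS hν]
  refine ⟨hexpansion, fun hτ₃ => hexpansion.congr' ?_⟩
  filter_upwards [eventually_ge_atTop 1] with n hn
  simp only [hτ₃ n hn, mul_zero, add_zero, sub_zero]
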